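/- **Setting.** Let $\{\mathbb E^i;\rho^{ji}\}_{i\in\mathbb N}$ be a projective system of real Banach spaces and continuous linear maps $\rho^{ji}:\mathbb E^j\to\mathbb E^i$ ($j\ge i$), $\mathbb F=\varprojlim\mathbb E^i$, and let $\{M^i;\varphi^{ji}\}_{i\in\mathbb N}$ be a projective system of $C^\infty$ Banach manifolds, $M^i$ modelled on $\mathbb E^i$, and smooth maps $\varphi^{ji}:M^j\to M^i$; put $M=\varprojlim M^i$ (with the topology induced from the product). A *limit chart* of $M$ is a family of charts $\psi^i:U^i\to\mathbb E^i$ of the $M^i$ with $\varphi^{ji}(U^j)\subseteq U^i$ and $\psi^i\circ\varphi^{ji}=\rho^{ji}\circ\psi^j$ on $U^j$, such that $\varprojlim U^i$ is open in $M$ and $\varprojlim\psi^i(U^i)$ is open in $\mathbb F$. Assume that the domains $\varprojlim U^i$ of the limit charts cover $M$, so that $M$ is a Fréchet manifold modelled on $\mathbb F$. As usual identify $TM=\varprojlim TM^i$ and $T(TM)=\varprojlim T(TM^i)$. Smoothness on $\mathbb F$ is understood as: continuous and mapping smooth curves to smooth curves. For a smooth curve $f$ (in $M$ or in $M^i$)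 with $f(0)=x$ let $[f,x]_2$ be its class modulo $f\approx g\iff f(0)=g(0),\ f'(0)=g'(0),\ f''(0)=g''(0)$, where $f'$ is a curve in the tangent bundle and $f''$ is a curve in the double tangent bundle; $T^2M$ and $T^2M^i$ are the sets of these classes, $\pi_2$ and $\pi_2^i$ are the projections $[f,x]_2\mapsto x$, $g^{ji}:T^2M^j\to T^2M^i$ is $[f,x]_2\mapsto[\varphi^{ji}\circ f,\varphi^{ji}(x)]_2$, and $F^i:T^2M\to T^2M^i$ is induced likewise by the projection $M\to M^i$. $T^2M^i$ carries its natural smooth structure, with charts $[f,x]_2\mapsto(\psi(x),(\psi\circ f)'(0),(\psi\circ f)''(0))$, $\psi$ a chart of $M^i$. Let $\mathcal H^0(\mathbb F\times\mathbb F)$ be the group of all $(l^i)\in\prod_i GL(\mathbb E^i\times\mathbb E^i)$ with $(\rho^{ji}\times\rho^{ji})\circ l^j=l^i\circ(\rho^{ji}\times\rho^{ji})$ for $j\ge i$. That $T^2M$ is an *$\mathcal H^0(\mathbb F\times\mathbb F)$-Fréchet vector bundle over $M$* means that there is given a family, indexed by $\alpha\in I$, of open sets $U^i_\alpha\subseteq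 M^i$ with $\varphi^{ji}(U^j_\alpha)\subseteq U^i_\alpha$ and $U_\alpha=\varprojlim U_\alpha^i$ open in $M$, and of diffeomorphisms $\Phi^i_\alpha:(\pi^i_2)^{-1}(U^i_\alpha)\to U^i_\alpha\times\mathbb E^i\times\mathbb E^i$ over $U_\alpha^i$ with $\Phi_\alpha^i\circ g^{ji}=(\varphi^{ji}\times\rho^{ji}\times\rho^{ji})\circ\Phi_\alpha^j$, such that * for each $i$ the sets $U^i_\alpha$ cover $M^i$, and the sets $U_\alpha$ cover $M$; * the limit $\Phi_\alpha:\pi_2^{-1}(U_\alpha)\to U_\alpha\times\mathbb F\times\mathbb F$ (the map with components $\Phi^i_\alpha\circ F^i$) exists and is bijective; * $\Phi^i_{\alpha,x}\circ(\Phi^i_{\beta,x})^{-1}=T^i_{\alpha\beta}(x)$ with smooth maps $T^i_{\alpha\beta}:U^i_\alpha\cap U^i_\beta\to GL(\mathbb E^i\times\mathbb E^i)$, and $(T^i_{\alpha\beta}(x^i))_i\in\mathcal H^0(\mathbb F\times\mathbb F)$ for $x=(x^i)\in U_\alpha\cap U_\beta$. That it is *isomorphic to $TM\times TM$* (the Whitney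 sum, with fibre $T_xM\times T_xM$) means that there is a bijection $G:T^2M\to TM\times TM$ over $\mathrm{id}_M$ such that each point of $M$ lies in some $U_\alpha$ and in the domain $\varprojlim V^i$ of some limit chart $(\psi^i:V^i\to\mathbb E^i)$ with respect to which $G$ has the form $(a,b)\mapsto\varprojlim l^i(x^i)\,(a,b)$ on the fibre over $x=(x^i)$ (for the trivialization $\varprojlim(T\psi^i\times T\psi^i)$ of $TM\times TM$), where $l^i:U^i_\alpha\cap V^i\to GL(\mathbb E^i\times\mathbb E^i)$ are smooth and $(l^i(x^i))_i\in\mathcal H^0(\mathbb F\times\mathbb F)$. A *linear connection* on $M^i$ is a map $D^i:T(TM^i)\to TM^i$ which, in the charts induced by any chart $\psi:U\to\mathbb E^i$ of $M^i$, has the form $(y,u,v,w)\mapsto(y,w+\Gamma(y)(u)(v))$ with a smooth $\Gamma:\psi(U)\to\mathcal L(\mathbb E^i,\mathcal L(\mathbb E^i,\mathbb E^i))$. A linear connection on $M$ is a map $D:T(TM)\to TM$ which, in the charts induced by any limit chart with image $V\subseteq\mathbb F$, has this form with $\Gamma(y):\mathbb F\times\mathbb F\to\mathbb F$ bilinear and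 $(y,u,v)\mapsto\Gamma(y)(u)(v)$ smooth on $V\times\mathbb F\times\mathbb F$. **Theorem.** If $T^2M$ is an $\mathcal H^0(\mathbb F\times\mathbb F)$-Fréchet vector bundle over $M=\varprojlim M^i$ isomorphic to $TM\times TM$, then $M$ admits a linear connection $D$ which is a projective limit of linear connections: there are linear connections $D^i$ on the manifolds $M^i$ with $T\varphi^{ji}\circ D^j=D^i\circ T(T\varphi^{ji})$ for all $j\ge i$ and $D=\varprojlim D^i$. -/

import Mathlib

open scoped Manifold ContDiff Topology
open Set Filter

namespace SecondTangent

section Manifolds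

variable {E : Type*} [NormedAddCommGroup E] [NormedSpace ℝ E]
  {M : Type*} [TopologicalSpace M] [ChartedSpace E M] [IsManifold 𝓘(ℝ, E) ∞ M]
  {E' : Type*} [NormedAddCommGroup E'] [NormedSpace ℝ E']
  {M' : Type*} [TopologicalSpace M'] [ChartedSpace E' M'] [IsManifold 𝓘(ℝ, E') ∞ M']

/-- The tangent bundle `TM` of a smooth manifold `M` modelled on `E`. -/
abbrev TM (E : Type*) [NormedAddCommGroup E] [NormedSpace ℝ E]
    (M : Type*) [TopologicalSpace M] [ChartedSpace E M] [IsManifold 𝓘(ℝ, E) ∞ M] : Type _ :=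
  TangentBundle 𝓘(ℝ, E) M

/-- The double tangent bundle `T(TM)`. -/
abbrev TTM (E : Type*) [NormedAddCommGroup E] [NormedSpace ℝ E]
    (M : Type*) [TopologicalSpace M] [ChartedSpace E M] [IsManifold 𝓘(ℝ, E) ∞ M] : Type _ :=
  TangentBundle 𝓘(ℝ, E).tangent (TM E M)

/-- `f'(t) = [df(t)](1)`, a point of `TM`. -/
noncomputable def velocity (f : ℝ → M) (t : ℝ) : TM E M :=
  tangentMap 𝓘(ℝ, ℝ) 𝓘(ℝ, E) f ⟨t, (1 : ℝ)⟩

/-- `f''(t) = [df'(t)](1)`, a point of `T(TM)`. -/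
noncomputable def acceleration (f : ℝ → M) (t : ℝ) : TTM E M :=
  tangentMap 𝓘(ℝ, ℝ) 𝓘(ℝ, E).tangent (velocity (E := E) f) ⟨t, (1 : ℝ)⟩

/-- The tangent map `Tg : TM → TM'`. -/
noncomputable def tmap (g : M → M') : TM E M → TM E' M' :=
  tangentMap 𝓘(ℝ, E) 𝓘(ℝ, E') g

/-- The second tangent map `T(Tg) : T(TM) → T(TM')`. -/
noncomputable def ttmap (g : M → M') : TTM E M → TTM E' M' :=
  tangentMap 𝓘(ℝ, E).tangent 𝓘(ℝ, E').tangent (tmap (E := E) (E' := E') g)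

/-- The chart `Ψ` of `TM` induced by a chart `ψ` of `M` (meaningful over the domain of `ψ`):
`[c, x] ↦ (ψ x, (ψ ∘ c)'(0))`. -/
noncomputable def tanCoord (e : OpenPartialHomeomorph M E) (v : TM E M) : E × E :=
  (e v.proj, mfderiv 𝓘(ℝ, E) 𝓘(ℝ, E) e v.proj v.2)

/-- The chart `TΨ` of `T(TM)` induced by a chart `ψ` of `M` (meaningful over the domain of `ψ`);
its value `((y, u), (v, w))` has footpoint `(y, u)` in `TM` and principal part `(v, w)`. -/
noncomputable def ttanCoord (e : OpenPartialHomeomorph M E) (Z : TTM E M) : (E × E) × (E × E) :=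
  (tanCoord e Z.proj, mfderiv 𝓘(ℝ, E).tangent 𝓘(ℝ, E × E) (tanCoord e) Z.proj Z.2)

theorem contMDiff_unit : ContMDiff 𝓘(ℝ, ℝ) 𝓘(ℝ, ℝ).tangent ∞
    (fun t : ℝ => (⟨t, (1 : ℝ)⟩ : TangentBundle 𝓘(ℝ, ℝ) ℝ)) := by
  exact contMDiff_vectorSpace_iff_contDiff (V := fun _ : ℝ => (1 : ℝ)).2 contDiff_const

theorem contMDiffOn_tangentMap {g : M → M'} {s : Set M} (hs : IsOpen s)
    (hg : ContMDiffOn 𝓘(ℝ, E) 𝓘(ℝ, E') ∞ g s) :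
    ContMDiffOn 𝓘(ℝ, E).tangent 𝓘(ℝ, E').tangent ∞ (tangentMap 𝓘(ℝ, E) 𝓘(ℝ, E') g)
      {v : TM E M | v.proj ∈ s} := by
  have : IsManifold 𝓘(ℝ, E) 1 M := inferInstance
  refine (hg.contMDiffOn_tangentMapWithin (m := ∞) (by simp) hs.uniqueMDiffOn).congr ?_
  intro v hv
  exact (tangentMapWithin_eq_tangentMap (hs.uniqueMDiffWithinAt hv)
    ((hg.contMDiffAt (hs.mem_nhds hv)).mdifferentiableAt (by simp))).symm

theorem isOpen_over {s : Set M} (hs : IsOpen s) : IsOpen {v : TM E M | v.proj ∈ s} :=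
  hs.preimage (FiberBundle.continuous_proj E (TangentSpace 𝓘(ℝ, E) (M := M)))


theorem contMDiffOn_velocity {f : ℝ → M} {s : Set ℝ} (hs : IsOpen s)
    (hf : ContMDiffOn 𝓘(ℝ, ℝ) 𝓘(ℝ, E) ∞ f s) :
    ContMDiffOn 𝓘(ℝ, ℝ) 𝓘(ℝ, E).tangent ∞ (velocity (E := E) f) s :=
  (contMDiffOn_tangentMap hs hf).comp contMDiff_unit.contMDiffOn fun _ ht => ht

theorem contMDiffOn_tanCoord {e : OpenPartialHomeomorph M E}
    (he : e ∈ IsManifold.maximalAtlas 𝓘(ℝ, E) ∞ M) :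
    ContMDiffOn 𝓘(ℝ, E).tangent 𝓘(ℝ, E × E) ∞ (tanCoord e) {v : TM E M | v.proj ∈ e.source} := by
  have h := contMDiffOn_tangentMap e.open_source (contMDiffOn_of_mem_maximalAtlas he)
  have h1 : ContMDiffOn 𝓘(ℝ, E).tangent 𝓘(ℝ, E) ∞ (fun v : TM E M => (tanCoord e v).1)
      {v : TM E M | v.proj ∈ e.source} :=
    (contMDiffOn_of_mem_maximalAtlas he).comp
      (Bundle.contMDiff_proj (TangentSpace 𝓘(ℝ, E) (M := M))).contMDiffOn fun _ hv => hv
  have h2 : ContMDiffOn 𝓘(ℝ, E).tangent 𝓘(ℝ, E) ∞ (fun v : TM E M => (tanCoord e v).2)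
      {v : TM E M | v.proj ∈ e.source} :=
    (contMDiff_snd_tangentBundle_modelSpace E 𝓘(ℝ, E)).comp_contMDiffOn h
  exact h1.prodMk_space h2

theorem velocity_comp {g : M → M'} {f : ℝ → M} {t : ℝ}
    (hg : MDifferentiableAt 𝓘(ℝ, E) 𝓘(ℝ, E') g (f t))
    (hf : MDifferentiableAt 𝓘(ℝ, ℝ) 𝓘(ℝ, E) f t) :
    velocity (E := E') (fun r => g (f r)) t = tmap g (velocity (E := E) f t) :=
  tangentMap_comp_at (g := g) (f := f) ⟨t, (1 : ℝ)⟩ hg hf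

theorem acceleration_comp {g : M → M'} {f : ℝ → M} {s : Set ℝ} {U : Set M} (hs : IsOpen s)
    (hU : IsOpen U) (hg : ContMDiffOn 𝓘(ℝ, E) 𝓘(ℝ, E') ∞ g U)
    (hf : ContMDiffOn 𝓘(ℝ, ℝ) 𝓘(ℝ, E) ∞ f s) {t : ℝ} (ht : t ∈ s) (hU' : f t ∈ U) :
    acceleration (E := E') (fun r => g (f r)) t = ttmap g (acceleration (E := E) f t) := by
  have hc : ContinuousAt f t := (hf.continuousOn.continuousAt (hs.mem_nhds ht))
  have hev : velocity (E := E') (fun r => g (f r)) =ᶠ[𝓝 t]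
      tmap (E := E) (E' := E') g ∘ velocity (E := E) f := by
    filter_upwards [hs.mem_nhds ht, hc.preimage_mem_nhds (hU.mem_nhds hU')] with r hr hr'
    exact velocity_comp ((hg.contMDiffAt (hU.mem_nhds hr')).mdifferentiableAt (by simp))
      ((hf.contMDiffAt (hs.mem_nhds hr)).mdifferentiableAt (by simp))
  have h1 : acceleration (E := E') (fun r => g (f r)) t = tangentMap 𝓘(ℝ, ℝ) 𝓘(ℝ, E').tangent
      (tmap (E := E) (E' := E') g ∘ velocity (E := E) f) ⟨t, (1 : ℝ)⟩ := by
    unfold acceleration tangentMap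
    simp only
    rw [hev.mfderiv_eq]
    congr 1
    exact hev.self_of_nhds
  rw [h1]
  refine tangentMap_comp_at (g := tmap (E := E) (E' := E') g) (f := velocity (E := E) f)
    ⟨t, (1 : ℝ)⟩ ?_ ?_
  · exact ((contMDiffOn_tangentMap hU hg).contMDiffAt
      ((isOpen_over hU).mem_nhds hU')).mdifferentiableAt (by simp)
  · exact ((contMDiffOn_velocity hs hf).contMDiffAt (hs.mem_nhds ht)).mdifferentiableAt (by simp)

theorem tanCoord_velocity {e : OpenPartialHomeomorph M E}
    (he : e ∈ IsManifold.maximalAtlas 𝓘(ℝ, E) ∞ M) {f : ℝ → M} {t : ℝ}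
    (hf : MDifferentiableAt 𝓘(ℝ, ℝ) 𝓘(ℝ, E) f t) (ht : f t ∈ e.source) :
    tanCoord e (velocity (E := E) f t) = (e (f t), deriv (fun r => e (f r)) t) := by
  have he' : MDifferentiableAt 𝓘(ℝ, E) 𝓘(ℝ, E) e (f t) :=
    (contMDiffAt_of_mem_maximalAtlas he ht).mdifferentiableAt (by simp)
  refine Prod.ext rfl ?_
  have h := mfderiv_comp t he' hf
  have h2 : deriv (fun r => e (f r)) t = mfderiv 𝓘(ℝ, ℝ) 𝓘(ℝ, E) (e ∘ f) t (1 : ℝ) := by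
    rw [mfderiv_eq_fderiv]; rfl
  rw [h2, h]
  rfl

theorem ttanCoord_acceleration {e : OpenPartialHomeomorph M E}
    (he : e ∈ IsManifold.maximalAtlas 𝓘(ℝ, E) ∞ M) {f : ℝ → M} {s : Set ℝ} (hs : IsOpen s)
    (hf : ContMDiffOn 𝓘(ℝ, ℝ) 𝓘(ℝ, E) ∞ f s) {t : ℝ} (ht : t ∈ s) (hU : f t ∈ e.source) :
    ttanCoord e (acceleration (E := E) f t) =
      ((e (f t), deriv (fun r => e (f r)) t),
       (deriv (fun r => e (f r)) t, deriv (deriv fun r => e (f r)) t)) := by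
  have hc : ContinuousAt f t := (hf.continuousOn.continuousAt (hs.mem_nhds ht))
  have hd : ∀ r ∈ s, MDifferentiableAt 𝓘(ℝ, ℝ) 𝓘(ℝ, E) f r := fun r hr =>
    (hf.contMDiffAt (hs.mem_nhds hr)).mdifferentiableAt (by simp)
  have hev : (tanCoord e ∘ velocity (E := E) f) =ᶠ[𝓝 t]
      fun r => (e (f r), deriv (fun r => e (f r)) r) := by
    filter_upwards [hs.mem_nhds ht, hc.preimage_mem_nhds (e.open_source.mem_nhds hU)] with r hr hr'
    exact tanCoord_velocity he (hd r hr) hr'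
  have hC := (contMDiffOn_tanCoord he).contMDiffAt
      ((isOpen_over e.open_source).mem_nhds (x := velocity (E := E) f t) hU)
  have hV := (contMDiffOn_velocity hs hf).contMDiffAt (hs.mem_nhds ht)
  have hcomp := mfderiv_comp t (hC.mdifferentiableAt (by simp)) (hV.mdifferentiableAt (by simp))
  rw [mfderiv_eq_fderiv, hev.fderiv_eq] at hcomp
  refine Prod.ext (tanCoord_velocity he (hd t ht) hU) ?_
  have hsm : ContDiffAt ℝ ∞ (fun r => e (f r)) t :=
    ((contMDiffAt_of_mem_maximalAtlas he hU).comp t (hf.contMDiffAt (hs.mem_nhds ht))).contDiffAt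
  have hdd : DifferentiableAt ℝ (deriv fun r => e (f r)) t := by
    have : ContDiffAt ℝ 1 (fderiv ℝ (fun r => e (f r))) t := hsm.fderiv_right (by norm_cast)
    have h2 := (this.differentiableAt (by simp)).clm_apply (differentiableAt_const (1 : ℝ))
    exact h2
  have hD : HasDerivAt (fun r => (e (f r), deriv (fun r => e (f r)) r))
      (deriv (fun r => e (f r)) t, deriv (deriv fun r => e (f r)) t) t :=
    (hsm.differentiableAt (by simp)).hasDerivAt.prodMk hdd.hasDerivAt
  have h3 := congrArg (fun L : ℝ →L[ℝ] E × E => L 1) hcomp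
  simp only [hD.hasFDerivAt.fderiv] at h3
  refine Eq.trans ?_ (h3.symm.trans (by simp))
  rfl

/-- Smooth curves `(-ε, ε) → M`, some `ε > 0`, represented by functions on `ℝ` whose values
outside `(-ε, ε)` are irrelevant. -/
structure Curve (E : Type*) [NormedAddCommGroup E] [NormedSpace ℝ E]
    (M : Type*) [TopologicalSpace M] [ChartedSpace E M] [IsManifold 𝓘(ℝ, E) ∞ M] where
  toFun : ℝ → M
  smooth : ∃ ε : ℝ, 0 < ε ∧ ContMDiffOn 𝓘(ℝ, ℝ) 𝓘(ℝ, E) ∞ toFun (Ioo (-ε) ε)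

/-- Two curves through the same point are equivalent if they agree up to their acceleration:
`f'(0) = g'(0)` and `f''(0) = g''(0)`. -/
def Curve.setoid (E : Type*) [NormedAddCommGroup E] [NormedSpace ℝ E]
    (M : Type*) [TopologicalSpace M] [ChartedSpace E M] [IsManifold 𝓘(ℝ, E) ∞ M] :
    Setoid (Curve E M) where
  r f g := f.toFun 0 = g.toFun 0 ∧
    velocity (E := E) f.toFun 0 = velocity (E := E) g.toFun 0 ∧
    acceleration (E := E) f.toFun 0 = acceleration (E := E) g.toFun 0
  iseqv := ⟨fun _ => ⟨rfl, rfl, rfl⟩, fun h => ⟨h.1.symm, h.2.1.symm, h.2.2.symm⟩,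
    fun h k => ⟨h.1.trans k.1, h.2.1.trans k.2.1, h.2.2.trans k.2.2⟩⟩

/-- The tangent bundle of order two `T²M`, as a set. -/
def T2 (E : Type*) [NormedAddCommGroup E] [NormedSpace ℝ E]
    (M : Type*) [TopologicalSpace M] [ChartedSpace E M] [IsManifold 𝓘(ℝ, E) ∞ M] : Type _ :=
  Quotient (Curve.setoid E M)

/-- The class `[f, f(0)]₂`. -/
def T2.mk (f : Curve E M) : T2 E M := Quotient.mk (Curve.setoid E M) f

/-- The projection `π₂ : T²M → M`. -/
def T2.base (τ : T2 E M) : M :=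
  Quotient.lift (s := Curve.setoid E M) (fun f : Curve E M => f.toFun 0) (fun _ _ h => h.1) τ

open Classical in
/-- The chart of `T²M` induced by a chart `ψ` of `M`:
`[f, x]₂ ↦ (ψ x, (ψ ∘ f)'(0), (ψ ∘ f)''(0))` for `x` in the domain of `ψ`
(and a junk value elsewhere). -/
noncomputable def T2.coord (e : OpenPartialHomeomorph M E)
    (he : e ∈ IsManifold.maximalAtlas 𝓘(ℝ, E) ∞ M) (τ : T2 E M) : E × E × E :=
  Quotient.lift (s := Curve.setoid E M)
    (fun f : Curve E M =>
      if f.toFun 0 ∈ e.source then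
        (e (f.toFun 0), deriv (fun t => e (f.toFun t)) 0, deriv (deriv fun t => e (f.toFun t)) 0)
      else 0)
    (by
      rintro f g ⟨h0, -, h2⟩
      obtain ⟨ε, hε, hf⟩ := f.smooth
      obtain ⟨δ, hδ, hg⟩ := g.smooth
      by_cases hs : f.toFun 0 ∈ e.source
      · have h := ttanCoord_acceleration he isOpen_Ioo hf (t := 0) ⟨by linarith, hε⟩ hs
        rw [h2, ttanCoord_acceleration he isOpen_Ioo hg (t := 0) ⟨by linarith, hδ⟩ (h0 ▸ hs)] at h
        simp only [Prod.mk.injEq] at h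
        simp only [if_pos hs, if_pos (h0 ▸ hs : g.toFun 0 ∈ e.source), Prod.mk.injEq]
        exact ⟨h.1.1.symm, h.1.2.symm, h.2.2.symm⟩
      · simp only [if_neg hs, if_neg (h0 ▸ hs : g.toFun 0 ∉ e.source)])
    τ

/-- The image `g ∘ f` of a smooth curve under a smooth map. -/
def Curve.map (g : M → M') (hg : ContMDiff 𝓘(ℝ, E) 𝓘(ℝ, E') ∞ g) (f : Curve E M) :
    Curve E' M' where
  toFun t := g (f.toFun t)
  smooth := by
    obtain ⟨ε, hε, hf⟩ := f.smooth
    exact ⟨ε, hε, hg.comp_contMDiffOn hf⟩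

/-- The map `T²M → T²M'`, `[f, x]₂ ↦ [g ∘ f, g(x)]₂` induced by a smooth map `g : M → M'`. -/
def T2.map (g : M → M') (hg : ContMDiff 𝓘(ℝ, E) 𝓘(ℝ, E') ∞ g) (τ : T2 E M) : T2 E' M' :=
  Quotient.lift (s := Curve.setoid E M) (fun f : Curve E M => T2.mk (f.map g hg))
    (by
      rintro f f₁ ⟨h0, h1, h2⟩
      obtain ⟨ε, hε, hf⟩ := f.smooth
      obtain ⟨δ, hδ, hf₁⟩ := f₁.smooth
      have m : (0 : ℝ) ∈ Ioo (-ε) ε := ⟨by linarith, hε⟩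
      have m₁ : (0 : ℝ) ∈ Ioo (-δ) δ := ⟨by linarith, hδ⟩
      refine Quotient.sound (s := Curve.setoid E' M') ⟨congrArg g h0, ?_, ?_⟩
      · have a := velocity_comp (t := 0) (hg.mdifferentiable (by simp) (f.toFun 0))
          ((hf.contMDiffAt (isOpen_Ioo.mem_nhds m)).mdifferentiableAt (by simp))
        have b := velocity_comp (t := 0) (hg.mdifferentiable (by simp) (f₁.toFun 0))
          ((hf₁.contMDiffAt (isOpen_Ioo.mem_nhds m₁)).mdifferentiableAt (by simp))
        exact a.trans ((congrArg _ h1).trans b.symm)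
      · have a := acceleration_comp isOpen_Ioo isOpen_univ hg.contMDiffOn hf m (mem_univ _)
        have b := acceleration_comp isOpen_Ioo isOpen_univ hg.contMDiffOn hf₁ m₁ (mem_univ _)
        exact a.trans ((congrArg _ h2).trans b.symm))
    τ

/-- `Φ` is (the principal part of) a smooth trivialization `τ ↦ (π₂ τ, Φ τ)` of `T²M` over the open
set `U`: it maps every fibre over a point of `U` bijectively onto `E × E`, and
`π₂⁻¹(U) → U × E × E` is smooth with smooth inverse for the smooth structure of `T²M` given by
the charts `[f, x]₂ ↦ (ψ x, (ψ ∘ f)'(0), (ψ ∘ f)''(0))`. -/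
structure IsTrivialization (U : Set M) (Φ : T2 E M → E × E) : Prop where
  isOpen : IsOpen U
  bijOn : ∀ x ∈ U, BijOn Φ {τ | τ.base = x} univ
  smooth : ∀ (e : OpenPartialHomeomorph M E) (he : e ∈ IsManifold.maximalAtlas 𝓘(ℝ, E) ∞ M),
    ∃ G : E × E × E → E × E,
      ContDiffOn ℝ ∞ G ((e '' (e.source ∩ U)) ×ˢ univ) ∧
      ∀ τ : T2 E M, τ.base ∈ e.source ∩ U → Φ τ = G (τ.coord e he)
  smooth_symm : ∀ (e : OpenPartialHomeomorph M E)
      (he : e ∈ IsManifold.maximalAtlas 𝓘(ℝ, E) ∞ M),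
    ∃ H : E × E × E → E × E,
      ContDiffOn ℝ ∞ H ((e '' (e.source ∩ U)) ×ˢ univ) ∧
      ∀ τ : T2 E M, τ.base ∈ e.source ∩ U → (τ.coord e he).2 = H (e τ.base, Φ τ)

/-- `D : T(TM) → TM` is a linear connection on `M`: in the charts of `T(TM)` and `TM`
induced by a chart `ψ` of `M` it has the local form `(y, u, v, w) ↦ (y, w + Γ(y)(u)(v))`,
where `Γ`, the Christoffel symbol, is a smooth map from the image of `ψ` to `L(E, L(E, E))`. -/
def IsLinearConnection (D : TTM E M → TM E M) : Prop :=
  ∀ e ∈ IsManifold.maximalAtlas 𝓘(ℝ, E) ∞ M,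
    ∃ Γ : E → E →L[ℝ] E →L[ℝ] E, ContDiffOn ℝ ∞ Γ e.target ∧
      ∀ Z : TTM E M, Z.proj.proj ∈ e.source →
        (D Z).proj = Z.proj.proj ∧
        ∀ y u v w : E, ttanCoord e Z = ((y, u), (v, w)) →
          tanCoord e (D Z) = (y, w + Γ y u v)

end Manifolds

section FrechetCalculus

/-- A smooth curve in a (locally convex) topological vector space: all iterated derivatives
exist. -/
def IsSmoothCurve {F : Type*} [AddCommGroup F] [Module ℝ F] [TopologicalSpace F]
    (c : ℝ → F) : Prop :=
  ∃ d : ℕ → ℝ → F, d 0 = c ∧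
    ∀ (n : ℕ) (t : ℝ), Tendsto (slope (d n) t) (𝓝[≠] t) (𝓝 (d (n + 1) t))

/-- Smoothness of a map on a subset of a Fréchet space with values in a Fréchet space: the map is
continuous there and takes smooth curves to smooth curves (the smoothness of Kriegl and
Michor). -/
def IsSmoothOn {F G : Type*} [AddCommGroup F] [Module ℝ F] [TopologicalSpace F]
    [AddCommGroup G] [Module ℝ G] [TopologicalSpace G] (f : F → G) (s : Set F) : Prop :=
  ContinuousOn f s ∧ ∀ c : ℝ → F, (∀ t, c t ∈ s) → IsSmoothCurve c → IsSmoothCurve fun t => f (c t)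

end FrechetCalculus

section Systems

variable (E : ℕ → Type*) [∀ i, NormedAddCommGroup (E i)] [∀ i, NormedSpace ℝ (E i)]
  (M : ℕ → Type*) [∀ i, TopologicalSpace (M i)] [∀ i, ChartedSpace (E i) (M i)]
  [∀ i, IsManifold 𝓘(ℝ, E i) ∞ (M i)]

/-- A projective system `{Mⁱ; φʲⁱ}` of smooth manifolds, modelled on a projective system
`{Eⁱ; ρʲⁱ}` of normed spaces. -/
structure ProjSystem where
  ρ : ∀ {i j : ℕ}, i ≤ j → E j →L[ℝ] E i
  ρ_refl : ∀ (i : ℕ) (a : E i), ρ (le_refl i) a = a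
  ρ_trans : ∀ {i j k : ℕ} (hij : i ≤ j) (hjk : j ≤ k) (a : E k),
    ρ hij (ρ hjk a) = ρ (hij.trans hjk) a
  φ : ∀ {i j : ℕ}, i ≤ j → M j → M i
  smooth : ∀ {i j : ℕ} (h : i ≤ j), ContMDiff 𝓘(ℝ, E j) 𝓘(ℝ, E i) ∞ (φ h)
  φ_refl : ∀ (i : ℕ) (x : M i), φ (le_refl i) x = x
  φ_trans : ∀ {i j k : ℕ} (hij : i ≤ j) (hjk : j ≤ k) (x : M k),
    φ hij (φ hjk x) = φ (hij.trans hjk) x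

variable {E M}

namespace ProjSystem

variable (P : ProjSystem E M)

/-- The model space `F = lim Eⁱ`, with the topology induced from the product. -/
def modelSpace : Submodule ℝ (∀ i, E i) where
  carrier := {y | ∀ i j (h : i ≤ j), P.ρ h (y j) = y i}
  add_mem' := fun ha hb i j h => by simp [ha i j h, hb i j h]
  zero_mem' := fun i j h => by simp
  smul_mem' := fun c a ha i j h => by simp [ha i j h]

/-- The model space `F = lim Eⁱ` as a type. -/
abbrev F : Type _ := P.modelSpace

/-- `M = lim Mⁱ`, with the topology induced from the product. -/
abbrev Lim : Type _ := {x : ∀ i, M i // ∀ i j (h : i ≤ j), P.φ h (x j) = x i}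

/-- The tangent bundle `TM` of `M = lim Mⁱ`, identified with `lim TMⁱ`. -/
abbrev TLim : Type _ :=
  {v : ∀ i, TM (E i) (M i) // ∀ i j (h : i ≤ j), tmap (P.φ h) (v j) = v i}

/-- The double tangent bundle `T(TM)` of `M = lim Mⁱ`, identified with `lim T(TMⁱ)`. -/
abbrev TTLim : Type _ :=
  {Z : ∀ i, TTM (E i) (M i) // ∀ i j (h : i ≤ j), ttmap (P.φ h) (Z j) = Z i}

/-- The projection `TM → M`. -/
def TLim.base {P : ProjSystem E M} (v : P.TLim) : P.Lim :=
  ⟨fun i => (v.1 i).proj, fun i j h => congrArg (fun z => z.proj) (v.2 i j h)⟩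

/-- The projection `T(TM) → M`. -/
def TTLim.base {P : ProjSystem E M} (Z : P.TTLim) : P.Lim :=
  ⟨fun i => (Z.1 i).proj.proj, fun i j h => congrArg (fun z => z.proj.proj) (Z.2 i j h)⟩

/-- A projective system of charts `ψⁱ : Uⁱ → Eⁱ` of the `Mⁱ` whose limit
`lim ψⁱ : lim Uⁱ → F` is a chart of `M = lim Mⁱ`. -/
structure LimChart where
  chart : ∀ i, OpenPartialHomeomorph (M i) (E i)
  mem_atlas : ∀ i, chart i ∈ IsManifold.maximalAtlas 𝓘(ℝ, E i) ∞ (M i)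
  mapsTo : ∀ {i j : ℕ} (h : i ≤ j), MapsTo (P.φ h) (chart j).source (chart i).source
  compat : ∀ {i j : ℕ} (h : i ≤ j), ∀ x ∈ (chart j).source,
    chart i (P.φ h x) = P.ρ h (chart j x)
  isOpen_source : IsOpen {x : P.Lim | ∀ i, x.1 i ∈ (chart i).source}
  isOpen_target : IsOpen {y : P.F | ∀ i, y.1 i ∈ (chart i).target}

/-- `M = lim Mⁱ` is a Fréchet manifold modelled on `F = lim Eⁱ`: the limits of projective systems
of charts cover it. -/
def IsFrechetManifold : Prop :=
  ∀ x : P.Lim, ∃ c : P.LimChart, ∀ i, x.1 i ∈ (c.chart i).source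

namespace LimChart

variable {P} (c : P.LimChart)

/-- The domain `lim Uⁱ` of the chart `lim ψⁱ`. -/
def source : Set P.Lim := {x | ∀ i, x.1 i ∈ (c.chart i).source}

/-- The image of the chart `lim ψⁱ`. -/
def target : Set P.F := {y | ∀ i, y.1 i ∈ (c.chart i).target}

theorem tanCoord_tmap {i j : ℕ} (h : i ≤ j) (v : TM (E j) (M j))
    (hv : v.proj ∈ (c.chart j).source) :
    tanCoord (c.chart i) (tmap (P.φ h) v) =
      ((P.ρ h).prodMap (P.ρ h)) (tanCoord (c.chart j) v) := by
  refine Prod.ext (c.compat h _ hv) ?_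
  have hi : MDifferentiableAt 𝓘(ℝ, E i) 𝓘(ℝ, E i) (c.chart i) (P.φ h v.proj) :=
    (contMDiffAt_of_mem_maximalAtlas (c.mem_atlas i) (c.mapsTo h hv)).mdifferentiableAt (by simp)
  have hj : MDifferentiableAt 𝓘(ℝ, E j) 𝓘(ℝ, E j) (c.chart j) v.proj :=
    (contMDiffAt_of_mem_maximalAtlas (c.mem_atlas j) hv).mdifferentiableAt (by simp)
  have hφ := (P.smooth h).mdifferentiable (by simp) v.proj
  have hρ : MDifferentiableAt 𝓘(ℝ, E j) 𝓘(ℝ, E i) (P.ρ h) (c.chart j v.proj) :=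
    (P.ρ h).differentiableAt.mdifferentiableAt
  have hev : (c.chart i ∘ P.φ h) =ᶠ[𝓝 v.proj] (P.ρ h ∘ c.chart j) := by
    filter_upwards [(c.chart j).open_source.mem_nhds hv] with x hx using c.compat h x hx
  have h1 := mfderiv_comp v.proj hi hφ
  have h2 := mfderiv_comp v.proj hρ hj
  have h3 : mfderiv 𝓘(ℝ, E j) 𝓘(ℝ, E i) (c.chart i ∘ P.φ h) v.proj =
      mfderiv 𝓘(ℝ, E j) 𝓘(ℝ, E i) (P.ρ h ∘ c.chart j) v.proj := hev.mfderiv_eq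
  rw [h1, h2, mfderiv_eq_fderiv, ContinuousLinearMap.fderiv] at h3
  exact congrArg (fun L : E j →L[ℝ] E i => L v.2) h3

theorem ttanCoord_ttmap {i j : ℕ} (h : i ≤ j) (Z : TTM (E j) (M j))
    (hZ : Z.proj.proj ∈ (c.chart j).source) :
    ttanCoord (c.chart i) (ttmap (P.φ h) Z) =
      (((P.ρ h).prodMap (P.ρ h)).prodMap ((P.ρ h).prodMap (P.ρ h)))
        (ttanCoord (c.chart j) Z) := by
  refine Prod.ext (c.tanCoord_tmap h Z.proj hZ) ?_
  have hi := ((contMDiffOn_tanCoord (c.mem_atlas i)).contMDiffAt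
    ((isOpen_over (c.chart i).open_source).mem_nhds (x := tmap (P.φ h) Z.proj)
      (c.mapsTo h hZ))).mdifferentiableAt (by simp)
  have hj := ((contMDiffOn_tanCoord (c.mem_atlas j)).contMDiffAt
    ((isOpen_over (c.chart j).open_source).mem_nhds hZ)).mdifferentiableAt (by simp)
  have hφ : MDifferentiableAt 𝓘(ℝ, E j).tangent 𝓘(ℝ, E i).tangent
      (tmap (E := E j) (E' := E i) (P.φ h)) Z.proj :=
    ((contMDiffOn_tangentMap isOpen_univ (P.smooth h).contMDiffOn).contMDiffAt
      ((isOpen_over isOpen_univ).mem_nhds (mem_univ _))).mdifferentiableAt (by simp)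
  have hρ : MDifferentiableAt 𝓘(ℝ, E j × E j) 𝓘(ℝ, E i × E i)
      ((P.ρ h).prodMap (P.ρ h)) (tanCoord (c.chart j) Z.proj) :=
    ((P.ρ h).prodMap (P.ρ h)).differentiableAt.mdifferentiableAt
  have hev : (tanCoord (c.chart i) ∘ tmap (E := E j) (E' := E i) (P.φ h)) =ᶠ[𝓝 Z.proj]
      (((P.ρ h).prodMap (P.ρ h)) ∘ tanCoord (c.chart j)) := by
    filter_upwards [(isOpen_over (c.chart j).open_source).mem_nhds hZ] with v hv
      using c.tanCoord_tmap h v hv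
  have h1 := mfderiv_comp Z.proj hi hφ
  have h2 := mfderiv_comp Z.proj hρ hj
  have h3 : mfderiv 𝓘(ℝ, E j).tangent 𝓘(ℝ, E i × E i)
        (tanCoord (c.chart i) ∘ tmap (E := E j) (E' := E i) (P.φ h)) Z.proj =
      mfderiv 𝓘(ℝ, E j).tangent 𝓘(ℝ, E i × E i)
        (((P.ρ h).prodMap (P.ρ h)) ∘ tanCoord (c.chart j)) Z.proj := hev.mfderiv_eq
  rw [h1, h2, mfderiv_eq_fderiv, ContinuousLinearMap.fderiv] at h3
  exact congrArg (fun L : E j × E j →L[ℝ] E i × E i => L Z.2) h3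

/-- The chart `Ψ = lim Tψⁱ` of `TM`, with values in `F × F`. -/
noncomputable def tanCoord (v : P.TLim) (hv : v.base ∈ c.source) : P.F × P.F :=
  (⟨fun i => (SecondTangent.tanCoord (c.chart i) (v.1 i)).1, fun i j h => by
      beta_reduce; rw [← v.2 i j h, c.tanCoord_tmap h _ (hv j)]; rfl⟩,
   ⟨fun i => (SecondTangent.tanCoord (c.chart i) (v.1 i)).2, fun i j h => by
      beta_reduce; rw [← v.2 i j h, c.tanCoord_tmap h _ (hv j)]; rfl⟩)

/-- The chart `lim T(Tψⁱ)` of `T(TM)`, with values in `(F × F) × (F × F)`. -/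
noncomputable def ttanCoord (Z : P.TTLim) (hZ : Z.base ∈ c.source) :
    (P.F × P.F) × (P.F × P.F) :=
  ((⟨fun i => (SecondTangent.ttanCoord (c.chart i) (Z.1 i)).1.1, fun i j h => by
      beta_reduce; rw [← Z.2 i j h, c.ttanCoord_ttmap h _ (hZ j)]; rfl⟩,
    ⟨fun i => (SecondTangent.ttanCoord (c.chart i) (Z.1 i)).1.2, fun i j h => by
      beta_reduce; rw [← Z.2 i j h, c.ttanCoord_ttmap h _ (hZ j)]; rfl⟩),
   (⟨fun i => (SecondTangent.ttanCoord (c.chart i) (Z.1 i)).2.1, fun i j h => by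
      beta_reduce; rw [← Z.2 i j h, c.ttanCoord_ttmap h _ (hZ j)]; rfl⟩,
    ⟨fun i => (SecondTangent.ttanCoord (c.chart i) (Z.1 i)).2.2, fun i j h => by
      beta_reduce; rw [← Z.2 i j h, c.ttanCoord_ttmap h _ (hZ j)]; rfl⟩))

end LimChart

/-- `D : T(TM) → TM` is a linear connection on the Fréchet manifold `M = lim Mⁱ`: in the charts
induced by a limit chart it has the local form `(y, u, v, w) ↦ (y, w + Γ(y)(u)(v))`, where `Γ(y)`
is bilinear and `(y, u, v) ↦ Γ(y)(u)(v)` is smooth. -/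
def IsLinearConnection (D : P.TTLim → P.TLim) : Prop :=
  ∀ c : P.LimChart, ∃ Γ : P.F → P.F →ₗ[ℝ] P.F →ₗ[ℝ] P.F,
    IsSmoothOn (fun p : P.F × P.F × P.F => Γ p.1 p.2.1 p.2.2) (c.target ×ˢ univ) ∧
    ∀ (Z : P.TTLim) (hZ : Z.base ∈ c.source), ∃ hD : (D Z).base = Z.base,
      ∀ y u v w : P.F, c.ttanCoord Z hZ = ((y, u), (v, w)) →
        c.tanCoord (D Z) (hD.symm ▸ hZ) = (y, w + Γ y u v)

/-- A map `D : T(TM) → TM` is the projective limit of maps `Dⁱ : T(TMⁱ) → TMⁱ`, which form a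
projective system. -/
def IsProjLimit (D : P.TTLim → P.TLim) (Di : ∀ i, TTM (E i) (M i) → TM (E i) (M i)) : Prop :=
  (∀ {i j : ℕ} (h : i ≤ j) (Z : TTM (E j) (M j)),
    tmap (P.φ h) (Di j Z) = Di i (ttmap (P.φ h) Z)) ∧
  ∀ (Z : P.TTLim) (i : ℕ), (D Z).1 i = Di i (Z.1 i)

/-- Smooth curves in `M = lim Mⁱ`: smoothness in limit charts is smoothness of all components. -/
structure LimCurve where
  toFun : ℝ → P.Lim
  smooth : ∃ ε : ℝ, 0 < ε ∧
    ∀ i, ContMDiffOn 𝓘(ℝ, ℝ) 𝓘(ℝ, E i) ∞ (fun t => (toFun t).1 i) (Ioo (-ε) ε)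

/-- The component `φⁱ ∘ f` of a smooth curve in `M = lim Mⁱ`. -/
def LimCurve.comp {P : ProjSystem E M} (f : P.LimCurve) (i : ℕ) : Curve (E i) (M i) where
  toFun t := (f.toFun t).1 i
  smooth := by
    obtain ⟨ε, hε, h⟩ := f.smooth
    exact ⟨ε, hε, h i⟩

/-- Two curves in `M = lim Mⁱ` through the same point are equivalent if `f'(0) = g'(0)` in
`TM = lim TMⁱ` and `f''(0) = g''(0)` in `T(TM) = lim T(TMⁱ)`. -/
def LimCurve.setoid : Setoid P.LimCurve where
  r f g := f.toFun 0 = g.toFun 0 ∧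
    (∀ i, velocity (E := E i) (f.comp i).toFun 0 = velocity (E := E i) (g.comp i).toFun 0) ∧
    ∀ i, acceleration (E := E i) (f.comp i).toFun 0 = acceleration (E := E i) (g.comp i).toFun 0
  iseqv := ⟨fun _ => ⟨rfl, fun _ => rfl, fun _ => rfl⟩,
    fun h => ⟨h.1.symm, fun i => (h.2.1 i).symm, fun i => (h.2.2 i).symm⟩,
    fun h k => ⟨h.1.trans k.1, fun i => (h.2.1 i).trans (k.2.1 i),
      fun i => (h.2.2 i).trans (k.2.2 i)⟩⟩

/-- The tangent bundle of order two `T²M` of `M = lim Mⁱ`, as a set. -/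
def T2Lim : Type _ := Quotient (LimCurve.setoid P)

/-- The projection `π₂ : T²M → M`. -/
def T2Lim.base {P : ProjSystem E M} (τ : P.T2Lim) : P.Lim :=
  Quotient.lift (s := LimCurve.setoid P) (fun f : P.LimCurve => f.toFun 0) (fun _ _ h => h.1) τ

/-- The canonical map `T²M → T²Mⁱ`, `[f, x]₂ ↦ [φⁱ ∘ f, φⁱ(x)]₂`. -/
def T2Lim.proj {P : ProjSystem E M} (i : ℕ) (τ : P.T2Lim) : T2 (E i) (M i) :=
  Quotient.lift (s := LimCurve.setoid P) (fun f : P.LimCurve => T2.mk (f.comp i))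
    (fun _ _ h => Quotient.sound (s := Curve.setoid (E i) (M i))
      ⟨congrArg (fun x : P.Lim => x.1 i) h.1, h.2.1 i, h.2.2 i⟩) τ

/-- The group `H⁰(F × F)` of the sequences `(lⁱ)` of toplinear isomorphisms of `Eⁱ × Eⁱ` whose
projective limit exists. -/
def H0 : Subgroup (∀ i, (E i × E i) ≃L[ℝ] (E i × E i)) where
  carrier := {l | ∀ i j (h : i ≤ j) (a : E j × E j),
    (P.ρ h).prodMap (P.ρ h) (l j a) = l i ((P.ρ h).prodMap (P.ρ h) a)}
  mul_mem' := by
    intro l m hl hm i j h a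
    exact (hl i j h (m j a)).trans (congrArg (l i) (hm i j h a))
  one_mem' := fun i j h a => rfl
  inv_mem' := by
    intro l hl i j h a
    have := hl i j h ((l j).symm a)
    rw [ContinuousLinearEquiv.apply_symm_apply] at this
    exact ((l i).symm_apply_eq.2 this).symm

/-- A trivialization of `T²M → M` with fibre `F × F` over `lim Uⁱ` that is the projective limit of
smooth trivializations of the bundles `T²Mⁱ → Mⁱ` over `Uⁱ`. -/
structure LimTrivialization where
  /-- The sets `Uⁱ`. -/
  U : ∀ i, Set (M i)
  mapsTo : ∀ {i j : ℕ} (h : i ≤ j), MapsTo (P.φ h) (U j) (U i)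
  isOpen_lim : IsOpen {x : P.Lim | ∀ i, x.1 i ∈ U i}
  /-- The trivializations `Φⁱ` of `T²Mⁱ` (principal parts). -/
  Φ : ∀ i, T2 (E i) (M i) → E i × E i
  isTrivialization : ∀ i, IsTrivialization (U i) (Φ i)
  compat : ∀ {i j : ℕ} (h : i ≤ j) (τ : T2 (E j) (M j)), τ.base ∈ U j →
    Φ i (τ.map (P.φ h) (P.smooth h)) = (P.ρ h).prodMap (P.ρ h) (Φ j τ)
  /-- The trivialization `Φ = lim Φⁱ` of `T²M` (principal part). -/
  Φlim : P.T2Lim → P.F × P.F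
  bijOn : ∀ x : P.Lim, (∀ i, x.1 i ∈ U i) → BijOn Φlim {τ | τ.base = x} univ
  Φlim_eq : ∀ τ : P.T2Lim, (∀ i, τ.base.1 i ∈ U i) →
    ∀ i, ((Φlim τ).1.1 i, (Φlim τ).2.1 i) = Φ i (τ.proj i)

/-- The structure on `T²M` of a Fréchet vector bundle over `M = lim Mⁱ` with structural group
`H⁰(F × F)`: a family of limits of trivializations, which cover `M` and each `Mⁱ`, such
that the transition functions `Tⁱ(x) = Φⁱ_α,x ∘ (Φⁱ_β,x)⁻¹` are smooth maps with values in
`GL(Eⁱ × Eⁱ)` and together take values in `H⁰(F × F)`. -/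
structure H0VectorBundle where
  ι : Type*
  triv : ι → P.LimTrivialization
  cover : ∀ x : P.Lim, ∃ α, ∀ i, x.1 i ∈ (triv α).U i
  cover_factor : ∀ i (x : M i), ∃ α, x ∈ (triv α).U i
  transition : ∀ α β, ∃ T : ∀ i, M i → (E i × E i) ≃L[ℝ] (E i × E i),
    (∀ i, ContMDiffOn 𝓘(ℝ, E i) 𝓘(ℝ, (E i × E i) →L[ℝ] (E i × E i)) ∞
      (fun x => (T i x : (E i × E i) →L[ℝ] (E i × E i))) ((triv α).U i ∩ (triv β).U i)) ∧
    (∀ i (τ : T2 (E i) (M i)), τ.base ∈ (triv α).U i ∩ (triv β).U i →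
      (triv α).Φ i τ = T i τ.base ((triv β).Φ i τ)) ∧
    ∀ x : P.Lim, (∀ i, x.1 i ∈ (triv α).U i ∩ (triv β).U i) → (fun i => T i (x.1 i)) ∈ P.H0

/-- The bundle `TM × TM` over `M = lim Mⁱ`: pairs of tangent vectors with the same footpoint. -/
abbrev TMTM : Type _ := {p : P.TLim × P.TLim // p.1.base = p.2.base}

/-- The vector bundle `T²M` is isomorphic to `TM × TM`: there is a bijection over the identity
of `M` which, with respect to suitable trivializations of both bundles around each point (the ones
of `TM × TM` being `lim (Tψⁱ × Tψⁱ)`), is given by a smooth map with values in `H⁰(F × F)`, that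
is, by smooth maps `hⁱ` with values in `GL(Eⁱ × Eⁱ)`. -/
def H0VectorBundle.IsIsoTMTM {P : ProjSystem E M} (B : P.H0VectorBundle) : Prop :=
  ∃ G : P.T2Lim ≃ P.TMTM,
    (∀ τ, (G τ).1.1.base = τ.base) ∧
    ∀ x : P.Lim, ∃ (α : B.ι) (c : P.LimChart),
      (∀ i, x.1 i ∈ (B.triv α).U i) ∧ x ∈ c.source ∧
      ∃ l : ∀ i, M i → (E i × E i) ≃L[ℝ] (E i × E i),
        (∀ i, ContMDiffOn 𝓘(ℝ, E i) 𝓘(ℝ, (E i × E i) →L[ℝ] (E i × E i)) ∞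
          (fun z => (l i z : (E i × E i) →L[ℝ] (E i × E i)))
          ((B.triv α).U i ∩ (c.chart i).source)) ∧
        (∀ z : P.Lim, (∀ i, z.1 i ∈ (B.triv α).U i) → z ∈ c.source →
          (fun i => l i (z.1 i)) ∈ P.H0) ∧
        ∀ τ : P.T2Lim, (∀ i, τ.base.1 i ∈ (B.triv α).U i) → τ.base ∈ c.source → ∀ i,
          ((tanCoord (c.chart i) ((G τ).1.1.1 i)).2, (tanCoord (c.chart i) ((G τ).1.2.1 i)).2) =
            l i (τ.base.1 i) ((B.triv α).Φ i (τ.proj i))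

end ProjSystem

end Systems

end SecondTangent

/-! In a chart the fibre of T²M over a point is E × E, with velocity and acceleration (u, w) as
coordinates. A smooth map with local form θ acts on it by κ(u, w) = (Au, Aw + B(u, u)), where A = Dθ
and B = D²θ. The quadratic term B prevents the coordinates from defining an invariant linear
structure on the fibre. A symmetric Christoffel symbol Γ provides one through G(u, w) = (u, w + Γ(u,
u)), and Γ is recovered from this G as half the acceleration component of D²G(0)((u, 0), (v, 0)).

The proof reverses this for an arbitrary trivialization, which need not have that shape. If G is its
restriction to a fibre, written in the chart, then Γ(u, v) is defined as half the second component
of DG(0)⁻¹ D²G(0)((u, 0), (v, 0)) (`verticalSymbol`). If G' ∘ κ = L ∘ G with L continuous linear,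
differentiating twice at 0 gives AΓ(u, v) = Γ'(Au, Av) + B(u, v) (`verticalSymbol_transform`). This
is the transformation law of Christoffel symbols; L need not be invertible and A may go between
different spaces.

The single law is used in two ways. For the identity map, with L a transition map, it shows that the
connection on each Mⁱ depends neither on the chart nor on the trivialization
(`IsTrivialization.connection_eq`). For φʲⁱ, with L = ρʲⁱ × ρʲⁱ, it shows that the connections on Mʲ
and Mⁱ are related (`LinearAtlas.tmap_connection`, `H0VectorBundle.linearAt`). In limit charts φʲⁱ
becomes the linear map ρʲⁱ, so B = 0 and the symbols themselves have a projective limit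
(`H0VectorBundle.ρ_christoffel`), whose smoothness can be checked on components. -/

set_option linter.unusedSectionVars false
set_option linter.unusedVariables false

namespace SecondTangent

/-! ### Second derivatives of compositions, and the symbol extracted from a fibre diffeomorphism. -/

section Calculus

variable {E : Type*} [NormedAddCommGroup E] [NormedSpace ℝ E]
  {E' : Type*} [NormedAddCommGroup E'] [NormedSpace ℝ E']
  {V : Type*} [NormedAddCommGroup V] [NormedSpace ℝ V]
  {V' : Type*} [NormedAddCommGroup V'] [NormedSpace ℝ V']

/-- First two derivatives of `t ↦ g (c t)` for a curve `c`. -/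
theorem deriv_deriv_comp {g : E → E'} {c : ℝ → E} {t : ℝ} (hg : ContDiffAt ℝ ∞ g (c t))
    (hc : ContDiffAt ℝ ∞ c t) :
    deriv (fun r => g (c r)) t = fderiv ℝ g (c t) (deriv c t) ∧
    deriv (deriv fun r => g (c r)) t =
      fderiv ℝ g (c t) (deriv (deriv c) t) +
        fderiv ℝ (fderiv ℝ g) (c t) (deriv c t) (deriv c t) := by
  have hg1 : ∀ᶠ y in 𝓝 (c t), DifferentiableAt ℝ g y :=
    ((hg.of_le (m := 1) (by simp)).eventually (by simp)).mono
      fun y hy => hy.differentiableAt (by simp)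
  have hc1 : ∀ᶠ r in 𝓝 t, DifferentiableAt ℝ c r :=
    ((hc.of_le (m := 1) (by simp)).eventually (by simp)).mono
      fun y hy => hy.differentiableAt (by simp)
  have hev : deriv (fun r => g (c r)) =ᶠ[𝓝 t] fun r => fderiv ℝ g (c r) (deriv c r) := by
    filter_upwards [hc.continuousAt.eventually hg1, hc1] with r h1 h2
    exact (h1.hasFDerivAt.comp_hasDerivAt r h2.hasDerivAt).deriv
  refine ⟨hev.self_of_nhds, ?_⟩
  have hc' : HasDerivAt c (deriv c t) t := hc1.self_of_nhds.hasDerivAt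
  have hc'' : HasDerivAt (deriv c) (deriv (deriv c) t) t := by
    have : ContDiffAt ℝ 1 (fderiv ℝ c) t := hc.fderiv_right (by norm_cast)
    have h2 := (this.differentiableAt (by simp)).clm_apply (differentiableAt_const (1 : ℝ))
    exact DifferentiableAt.hasDerivAt h2
  have hg' : HasFDerivAt (fderiv ℝ g) (fderiv ℝ (fderiv ℝ g) (c t)) (c t) :=
    ((hg.fderiv_right (m := 1) (by norm_cast)).differentiableAt (by simp)).hasFDerivAt
  rw [hev.deriv_eq, add_comm]
  exact ((hg'.comp_hasDerivAt t hc').clm_apply hc'').deriv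

/-- Derivative of the tangent map `(y, u) ↦ (g y, Dg(y) u)` of `g`. -/
theorem hasFDerivAt_tangent {g : E → E'} {p : E × E} (hg : ContDiffAt ℝ ∞ g p.1)
    (a : E × E) :
    DifferentiableAt ℝ (fun q : E × E => (g q.1, fderiv ℝ g q.1 q.2)) p ∧
    fderiv ℝ (fun q : E × E => (g q.1, fderiv ℝ g q.1 q.2)) p a =
      (fderiv ℝ g p.1 a.1, fderiv ℝ g p.1 a.2 + fderiv ℝ (fderiv ℝ g) p.1 a.1 p.2) := by
  have h1 : HasFDerivAt g (fderiv ℝ g p.1) p.1 := (hg.differentiableAt (by simp)).hasFDerivAt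
  have h2 : HasFDerivAt (fderiv ℝ g) (fderiv ℝ (fderiv ℝ g) p.1) p.1 :=
    ((hg.fderiv_right (m := 1) (by norm_cast)).differentiableAt (by simp)).hasFDerivAt
  have h3 := (h1.comp p hasFDerivAt_fst).prodMk
    ((h2.comp p hasFDerivAt_fst).clm_apply hasFDerivAt_snd)
  have h4 : HasFDerivAt (fun q : E × E => (g q.1, fderiv ℝ g q.1 q.2)) _ p := h3
  refine ⟨h4.differentiableAt, ?_⟩
  rw [h4.fderiv]
  simp

/-- The vertical part `½ pr₂ (DG(0)⁻¹ D²G(0)((u, 0), (v, 0)))` of the Christoffel symbol at `0` of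
the flat connection given by the diffeomorphism `G` of `E × E` to a vector space. -/
noncomputable def verticalSymbol (G : E × E → V) : E →L[ℝ] E →L[ℝ] E :=
  (1 / 2 : ℝ) • (ContinuousLinearMap.compL ℝ E V E
      ((ContinuousLinearMap.snd ℝ E E).comp (ContinuousLinearMap.inverse (fderiv ℝ G 0)))).comp
    (((ContinuousLinearMap.compL ℝ E (E × E) V).flip (ContinuousLinearMap.inl ℝ E E)).comp
      ((fderiv ℝ (fderiv ℝ G) 0).comp (ContinuousLinearMap.inl ℝ E E)))

theorem verticalSymbol_apply (G : E × E → V) (u v : E) :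
    verticalSymbol G u v = (1 / 2 : ℝ) •
      (ContinuousLinearMap.inverse (fderiv ℝ G 0) (fderiv ℝ (fderiv ℝ G) 0 (u, 0) (v, 0))).2 := by
  simp [verticalSymbol]

/-- Transformation rule of `verticalSymbol` under a map `(u, w) ↦ (A u, A w + B u u)`. -/
theorem verticalSymbol_transform {G : E × E → V} {G' : E' × E' → V'}
    (hG : ContDiff ℝ ∞ G) (hG' : ContDiff ℝ ∞ G')
    (hi : (fderiv ℝ G 0).IsInvertible) (hi' : (fderiv ℝ G' 0).IsInvertible)
    (L : V →L[ℝ] V') (A : E →L[ℝ] E') (B : E →L[ℝ] E →L[ℝ] E') (hB : ∀ u v, B u v = B v u)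
    (h : ∀ u w, G' (A u, A w + B u u) = L (G (u, w))) (u v : E) :
    A (verticalSymbol G u v) = verticalSymbol G' (A u) (A v) + B u v := by
  set κ : E × E → E' × E' := fun p => (A p.1, A p.2 + B p.1 p.1) with hκ
  have hκ' : ∀ p : E × E, HasFDerivAt κ
      ((A.comp (ContinuousLinearMap.fst ℝ E E)).prod (A.comp (ContinuousLinearMap.snd ℝ E E) +
        ((B p.1).comp (ContinuousLinearMap.fst ℝ E E) +
          (B.comp (ContinuousLinearMap.fst ℝ E E)).flip p.1))) p := by
    intro p
    refine (A.hasFDerivAt.comp p hasFDerivAt_fst).prodMk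
      ((A.hasFDerivAt.comp p hasFDerivAt_snd).add ?_)
    exact (B.hasFDerivAt.comp p hasFDerivAt_fst).clm_apply hasFDerivAt_fst
  have hd : Differentiable ℝ G := hG.differentiable (by simp)
  have hd' : Differentiable ℝ G' := hG'.differentiable (by simp)
  have hdd : HasFDerivAt (fderiv ℝ G) (fderiv ℝ (fderiv ℝ G) 0) 0 :=
    ((hG.fderiv_right (m := 1) (by norm_cast)).differentiable (by simp) 0).hasFDerivAt
  have κ0 : κ 0 = 0 := by simp [hκ]
  have hdd' : HasFDerivAt (fderiv ℝ G') (fderiv ℝ (fderiv ℝ G') 0) (κ 0) := by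
    rw [κ0]
    exact ((hG'.fderiv_right (m := 1) (by norm_cast)).differentiable (by simp) 0).hasFDerivAt
  -- The relation G' ∘ κ = L ∘ G is differentiated once at an arbitrary point, so that it can be
  -- differentiated again below.
  have hfirst : ∀ p a : E × E, L (fderiv ℝ G p a) =
      fderiv ℝ G' (κ p) (A a.1, A a.2 + (B p.1 a.1 + B a.1 p.1)) := by
    intro p a
    have e1 : HasFDerivAt (fun p => L (G p)) (L.comp (fderiv ℝ G p)) p :=
      L.hasFDerivAt.comp p (hd p).hasFDerivAt
    have e2 : HasFDerivAt (fun p => G' (κ p)) _ p := (hd' (κ p)).hasFDerivAt.comp p (hκ' p)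
    have e3 : (fun p => G' (κ p)) = fun p => L (G p) := funext fun p => h p.1 p.2
    rw [e3] at e2
    have := congrArg (fun T : E × E →L[ℝ] V' => T a) (e1.unique e2)
    simpa using this
  -- The derivative of `hfirst` at 0 with a = (v, 0) fixed. The term with 2 B(u, v) is the second
  -- derivative of the quadratic part of κ; the 2 comes from the symmetry of B.
  have hsecond : L (fderiv ℝ (fderiv ℝ G) 0 (u, 0) (v, 0)) =
      fderiv ℝ (fderiv ℝ G') 0 (A u, 0) (A v, 0) + fderiv ℝ G' 0 (0, (2 : ℝ) • B u v) := by
    have e1 : HasFDerivAt (fun p => L (fderiv ℝ G p (v, 0))) _ 0 :=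
      L.hasFDerivAt.comp (0 : E × E) (hdd.clm_apply (hasFDerivAt_const ((v, 0) : E × E) 0))
    -- The summand `A 0` is kept so that the function is literally the argument produced by `hfirst
    -- p (v, 0)`.
    have e4 : HasFDerivAt (fun p : E × E => (A v, A 0 + (B p.1 v + B v p.1)))
        ((0 : E × E →L[ℝ] E').prod
          (((B.flip v).comp (ContinuousLinearMap.fst ℝ E E)) +
            (B v).comp (ContinuousLinearMap.fst ℝ E E))) 0 := by
      refine (hasFDerivAt_const _ _).prodMk ?_
      exact (((B.flip v).hasFDerivAt.comp (0 : E × E) hasFDerivAt_fst).add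
        ((B v).hasFDerivAt.comp (0 : E × E) hasFDerivAt_fst)).const_add _
    have e2 : HasFDerivAt (fun p => fderiv ℝ G' (κ p) (A v, A 0 + (B p.1 v + B v p.1))) _ 0 :=
      (hdd'.comp (0 : E × E) (hκ' 0)).clm_apply e4
    have e3 : (fun p => L (fderiv ℝ G p (v, 0))) =
        fun p => fderiv ℝ G' (κ p) (A v, A 0 + (B p.1 v + B v p.1)) :=
      funext fun p => hfirst p (v, 0)
    rw [← e3] at e2
    have := congrArg (fun T : E × E →L[ℝ] V' => T (u, 0)) (e1.unique e2)
    simp [κ0, hB v u, ← two_smul ℝ (B u v)] at this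
    rw [this, add_comm]
  set q := ContinuousLinearMap.inverse (fderiv ℝ G 0) (fderiv ℝ (fderiv ℝ G) 0 (u, 0) (v, 0))
    with hq
  have hq1 : fderiv ℝ (fderiv ℝ G) 0 (u, 0) (v, 0) = fderiv ℝ G 0 q :=
    hi.inverse_apply_eq.1 hq.symm
  -- At 0 the first-order relation reads L ∘ DG(0) = DG'(0) ∘ (A × A). Applied to q it moves the
  -- inverse from G to G' without inverting L.
  have h0 := hfirst 0 q
  rw [κ0, ← hq1, hsecond] at h0
  have hq' : ContinuousLinearMap.inverse (fderiv ℝ G' 0)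
      (fderiv ℝ (fderiv ℝ G') 0 (A u, 0) (A v, 0)) = (A q.1, A q.2) - (0, (2 : ℝ) • B u v) := by
    refine hi'.inverse_apply_eq.2 ?_
    rw [map_sub, eq_sub_iff_add_eq, h0]
    simp
  rw [verticalSymbol_apply, verticalSymbol_apply, hq', ← hq]
  simp [smul_sub, smul_smul]

/-- The symbol is built by continuous linear operations from the first two fibre derivatives at 0,
which depend smoothly on the parameter, and from the inverse of the first. Completeness enters
because inversion of operators is smooth near invertible ones. -/
theorem contDiffOn_verticalSymbol [CompleteSpace E] {W : Type*} [NormedAddCommGroup W]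
    [NormedSpace ℝ W] {s : Set W} (hs : IsOpen s) {G : W × (E × E) → V}
    (hG : ContDiffOn ℝ ∞ G (s ×ˢ univ))
    (hi : ∀ y ∈ s, (fderiv ℝ (fun a => G (y, a)) 0).IsInvertible) :
    ContDiffOn ℝ ∞ (fun y => verticalSymbol fun a => G (y, a)) s := by
  intro y hy
  refine ContDiffAt.contDiffWithinAt ?_
  have hGat : ∀ a : E × E, ContDiffAt ℝ ∞ G (y, a) := fun a =>
    hG.contDiffAt ((hs.prod isOpen_univ).mem_nhds ⟨hy, mem_univ _⟩)
  have h1 : ContDiffAt ℝ ∞ (fun z => fderiv ℝ (fun a => G (z, a)) 0) y :=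
    ContDiffAt.fderiv (f := fun z a => G (z, a)) (n := ∞) (hGat 0) contDiffAt_const (by simp)
  -- Joint smoothness in the parameter and the fibre variable is needed to take a second fibre
  -- derivative.
  have h1' : ContDiffAt ℝ ∞ (fun p : W × (E × E) => fderiv ℝ (fun a => G (p.1, a)) p.2) (y, 0) := by
    refine ContDiffAt.fderiv (f := fun (p : W × (E × E)) a => G (p.1, a)) (g := fun p => p.2)
      (n := ∞) ?_ contDiffAt_snd (by simp)
    exact ContDiffAt.comp (g := G) ((y, 0), 0) (hGat 0)
      ((contDiffAt_fst.comp _ contDiffAt_fst).prodMk contDiffAt_snd)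
  have h2 : ContDiffAt ℝ ∞ (fun z => fderiv ℝ (fderiv ℝ (fun a => G (z, a))) 0) y :=
    ContDiffAt.fderiv (f := fun z a => fderiv ℝ (fun a => G (z, a)) a) (n := ∞) h1'
      contDiffAt_const (by simp)
  obtain ⟨T, hT⟩ := hi y hy
  have h3 : ContDiffAt ℝ ∞
      (fun z => ContinuousLinearMap.inverse (fderiv ℝ (fun a => G (z, a)) 0)) y :=
    ContDiffAt.comp (g := ContinuousLinearMap.inverse) y (by
      rw [← hT]
      exact contDiffAt_map_inverse T) h1
  unfold verticalSymbol
  refine ContDiffAt.const_smul _ (ContDiffAt.clm_comp ?_ (ContDiffAt.clm_comp contDiffAt_const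
    (h2.clm_comp contDiffAt_const)))
  exact (ContinuousLinearMap.contDiff _).contDiffAt.comp y (contDiffAt_const.clm_comp h3)

end Calculus

end SecondTangent


namespace SecondTangent

/-! ### Tangent, double tangent and second order tangent maps in charts. -/

section Coordinates

variable {E : Type*} [NormedAddCommGroup E] [NormedSpace ℝ E]
  {M : Type*} [TopologicalSpace M] [ChartedSpace E M] [IsManifold 𝓘(ℝ, E) ∞ M]
  {E' : Type*} [NormedAddCommGroup E'] [NormedSpace ℝ E']
  {M' : Type*} [TopologicalSpace M'] [ChartedSpace E' M'] [IsManifold 𝓘(ℝ, E') ∞ M']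

/-- The map `g : M → M'` in charts `e` of `M` and `e'` of `M'`. -/
def localForm (e : OpenPartialHomeomorph M E) (e' : OpenPartialHomeomorph M' E') (g : M → M') :
    E → E' :=
  fun y => e' (g (e.symm y))

theorem localForm_chart {e : OpenPartialHomeomorph M E} (e' : OpenPartialHomeomorph M' E')
    (g : M → M') {x : M} (hx : x ∈ e.source) : localForm e e' g (e x) = e' (g x) := by
  simp [localForm, e.left_inv hx]

theorem contDiffAt_localForm {e : OpenPartialHomeomorph M E} {e' : OpenPartialHomeomorph M' E'}
    (he : e ∈ IsManifold.maximalAtlas 𝓘(ℝ, E) ∞ M)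
    (he' : e' ∈ IsManifold.maximalAtlas 𝓘(ℝ, E') ∞ M') {g : M → M'}
    (hg : ContMDiff 𝓘(ℝ, E) 𝓘(ℝ, E') ∞ g) {x : M} (hx : x ∈ e.source) (hx' : g x ∈ e'.source) :
    ContDiffAt ℝ ∞ (localForm e e' g) (e x) := by
  have h1 := contMDiffAt_symm_of_mem_maximalAtlas he (e.map_source hx)
  have h2 : ContMDiffAt 𝓘(ℝ, E') 𝓘(ℝ, E') ∞ e' (g (e.symm (e x))) :=
    contMDiffAt_of_mem_maximalAtlas he' (by rwa [e.left_inv hx])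
  exact (h2.comp (e x) ((hg _).comp (e x) h1)).contDiffAt

/-- The tangent map in charts: `(y, u) ↦ (θ y, Dθ(y) u)`. -/
theorem tanCoord_tmap {e : OpenPartialHomeomorph M E} {e' : OpenPartialHomeomorph M' E'}
    (he : e ∈ IsManifold.maximalAtlas 𝓘(ℝ, E) ∞ M)
    (he' : e' ∈ IsManifold.maximalAtlas 𝓘(ℝ, E') ∞ M') {g : M → M'}
    (hg : ContMDiff 𝓘(ℝ, E) 𝓘(ℝ, E') ∞ g) {v : TM E M} (hx : v.proj ∈ e.source)
    (hx' : g v.proj ∈ e'.source) :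
    tanCoord e' (tmap g v) = (localForm e e' g (tanCoord e v).1,
      fderiv ℝ (localForm e e' g) (tanCoord e v).1 (tanCoord e v).2) := by
  refine Prod.ext (localForm_chart e' g hx).symm ?_
  have hi : MDifferentiableAt 𝓘(ℝ, E') 𝓘(ℝ, E') e' (g v.proj) :=
    (contMDiffAt_of_mem_maximalAtlas he' hx').mdifferentiableAt (by simp)
  have hj : MDifferentiableAt 𝓘(ℝ, E) 𝓘(ℝ, E) e v.proj :=
    (contMDiffAt_of_mem_maximalAtlas he hx).mdifferentiableAt (by simp)
  have hφ := hg.mdifferentiable (by simp) v.proj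
  have hρ : MDifferentiableAt 𝓘(ℝ, E) 𝓘(ℝ, E') (localForm e e' g) (e v.proj) :=
    ((contDiffAt_localForm he he' hg hx hx').differentiableAt (by simp)).mdifferentiableAt
  have hev : (e' ∘ g) =ᶠ[𝓝 v.proj] (localForm e e' g ∘ e) := by
    filter_upwards [e.open_source.mem_nhds hx] with x hx using (localForm_chart e' g hx).symm
  have h1 := mfderiv_comp v.proj hi hφ
  have h2 := mfderiv_comp v.proj hρ hj
  have h3 : mfderiv 𝓘(ℝ, E) 𝓘(ℝ, E') (e' ∘ g) v.proj =
      mfderiv 𝓘(ℝ, E) 𝓘(ℝ, E') (localForm e e' g ∘ e) v.proj := hev.mfderiv_eq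
  rw [h1, h2, mfderiv_eq_fderiv] at h3
  exact congrArg (fun L : E →L[ℝ] E' => L v.2) h3

/-- The second tangent map in charts:
`(y, u, v, w) ↦ (θ y, Dθ(y) u, Dθ(y) v, Dθ(y) w + D²θ(y)(v, u))`. -/
theorem ttanCoord_ttmap {e : OpenPartialHomeomorph M E} {e' : OpenPartialHomeomorph M' E'}
    (he : e ∈ IsManifold.maximalAtlas 𝓘(ℝ, E) ∞ M)
    (he' : e' ∈ IsManifold.maximalAtlas 𝓘(ℝ, E') ∞ M') {g : M → M'}
    (hg : ContMDiff 𝓘(ℝ, E) 𝓘(ℝ, E') ∞ g) {Z : TTM E M} (hx : Z.proj.proj ∈ e.source)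
    (hx' : g Z.proj.proj ∈ e'.source) {y u v w : E} (hZ : ttanCoord e Z = ((y, u), (v, w))) :
    ttanCoord e' (ttmap g Z) = ((localForm e e' g y, fderiv ℝ (localForm e e' g) y u),
      (fderiv ℝ (localForm e e' g) y v, fderiv ℝ (localForm e e' g) y w +
        fderiv ℝ (fderiv ℝ (localForm e e' g)) y v u)) := by
  have hZ1 : tanCoord e Z.proj = (y, u) := congrArg Prod.fst hZ
  have hZ2 : mfderiv 𝓘(ℝ, E).tangent 𝓘(ℝ, E × E) (tanCoord e) Z.proj Z.2 = (v, w) :=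
    congrArg Prod.snd hZ
  refine Prod.ext ?_ ?_
  · have := tanCoord_tmap he he' hg hx hx'
    rw [hZ1] at this
    exact this
  have hi := ((contMDiffOn_tanCoord he').contMDiffAt
    ((isOpen_over e'.open_source).mem_nhds (x := tmap g Z.proj) hx')).mdifferentiableAt (by simp)
  have hj := ((contMDiffOn_tanCoord he).contMDiffAt
    ((isOpen_over e.open_source).mem_nhds hx)).mdifferentiableAt (by simp)
  have hφ : MDifferentiableAt 𝓘(ℝ, E).tangent 𝓘(ℝ, E').tangent
      (tmap (E := E) (E' := E') g) Z.proj :=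
    ((contMDiffOn_tangentMap isOpen_univ hg.contMDiffOn).contMDiffAt
      ((isOpen_over isOpen_univ).mem_nhds (mem_univ _))).mdifferentiableAt (by simp)
  have hθ := hasFDerivAt_tangent (p := tanCoord e Z.proj) (contDiffAt_localForm he he' hg hx hx')
  have hρ : MDifferentiableAt 𝓘(ℝ, E × E) 𝓘(ℝ, E' × E')
      (fun q : E × E => (localForm e e' g q.1, fderiv ℝ (localForm e e' g) q.1 q.2))
      (tanCoord e Z.proj) := (hθ 0).1.mdifferentiableAt
  have hopen : IsOpen {v : TM E M | v.proj ∈ e.source ∩ g ⁻¹' e'.source} :=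
    isOpen_over (e.open_source.inter (e'.open_source.preimage hg.continuous))
  have hev : (tanCoord e' ∘ tmap (E := E) (E' := E') g) =ᶠ[𝓝 Z.proj]
      ((fun q : E × E => (localForm e e' g q.1, fderiv ℝ (localForm e e' g) q.1 q.2)) ∘
        tanCoord e) := by
    filter_upwards [hopen.mem_nhds (x := Z.proj) ⟨hx, hx'⟩] with v hv
      using tanCoord_tmap he he' hg hv.1 hv.2
  have h1 := mfderiv_comp Z.proj hi hφ
  have h2 := mfderiv_comp Z.proj hρ hj
  have h3 : mfderiv 𝓘(ℝ, E).tangent 𝓘(ℝ, E' × E')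
        (tanCoord e' ∘ tmap (E := E) (E' := E') g) Z.proj =
      mfderiv 𝓘(ℝ, E).tangent 𝓘(ℝ, E' × E')
        ((fun q : E × E => (localForm e e' g q.1, fderiv ℝ (localForm e e' g) q.1 q.2)) ∘
          tanCoord e) Z.proj := hev.mfderiv_eq
  rw [h1, h2, mfderiv_eq_fderiv] at h3
  have h4 := congrArg (fun L : E × E →L[ℝ] E' × E' => L Z.2) h3
  have h5 := (hθ (v, w)).2
  rw [hZ1] at h5
  refine h4.trans (Eq.trans ?_ h5)
  refine Eq.trans ?_ (congrArg (fun p => fderiv ℝ (fun q : E × E =>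
    (localForm e e' g q.1, fderiv ℝ (localForm e e' g) q.1 q.2)) p (v, w)) hZ1)
  exact congrArg _ hZ2

theorem isInvertible_mfderiv_chart {e : OpenPartialHomeomorph M E}
    (he : e ∈ IsManifold.maximalAtlas 𝓘(ℝ, E) ∞ M) {x : M} (hx : x ∈ e.source) :
    (mfderiv 𝓘(ℝ, E) 𝓘(ℝ, E) e x).IsInvertible := by
  have h : e.MDifferentiable 𝓘(ℝ, E) 𝓘(ℝ, E) :=
    ⟨(contMDiffOn_of_mem_maximalAtlas he).mdifferentiableOn (by simp),
      (contMDiffOn_symm_of_mem_maximalAtlas he).mdifferentiableOn (by simp)⟩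
  exact ⟨h.mfderiv hx, rfl⟩

/-- The derivative of a chart is injective. This reduces equality of two connections to equality of
principal parts. -/
theorem tanCoord_injOn {e : OpenPartialHomeomorph M E}
    (he : e ∈ IsManifold.maximalAtlas 𝓘(ℝ, E) ∞ M) {X Y : TM E M} (hX : X.proj ∈ e.source)
    (hXY : X.proj = Y.proj) (h : (tanCoord e X).2 = (tanCoord e Y).2) : X = Y := by
  obtain ⟨x, a⟩ := X
  obtain ⟨y, b⟩ := Y
  obtain rfl : x = y := hXY
  exact congrArg _ ((isInvertible_mfderiv_chart he hX).injective h)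

/-- The tangent vector over `x` with principal part `a` in the chart `e`. -/
noncomputable def ofTanCoord (e : OpenPartialHomeomorph M E) (x : M) (a : E) : TM E M :=
  ⟨x, (mfderiv 𝓘(ℝ, E) 𝓘(ℝ, E) e x).inverse a⟩

theorem tanCoord_ofTanCoord {e : OpenPartialHomeomorph M E}
    (he : e ∈ IsManifold.maximalAtlas 𝓘(ℝ, E) ∞ M) {x : M} (hx : x ∈ e.source) (a : E) :
    tanCoord e (ofTanCoord e x a) = (e x, a) :=
  Prod.ext rfl (((isInvertible_mfderiv_chart he hx).inverse_apply_eq.1 rfl).symm)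

/-- Every velocity and acceleration is realized by a parabola in the chart. Hence an identity valid
for all classes over x becomes an identity between functions on all of E × E, which can be
differentiated. -/
theorem T2.exists_coord {e : OpenPartialHomeomorph M E}
    (he : e ∈ IsManifold.maximalAtlas 𝓘(ℝ, E) ∞ M) {x : M} (hx : x ∈ e.source) (a : E × E) :
    ∃ τ : T2 E M, τ.base = x ∧ τ.coord e he = (e x, a) := by
  -- The factor 1/2 makes the second derivative at 0 equal to `a.2`.
  set c : ℝ → E := fun t => e x + (t • a.1 + (t ^ 2 / 2) • a.2) with hc
  have hcs : ContDiff ℝ ∞ c := by fun_prop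
  have c0 : c 0 = e x := by simp [hc]
  have hmem : c ⁻¹' e.target ∈ 𝓝 (0 : ℝ) :=
    hcs.continuous.continuousAt.preimage_mem_nhds
      (e.open_target.mem_nhds (by rw [c0]; exact e.map_source hx))
  obtain ⟨ε, hε, hball⟩ := Metric.mem_nhds_iff.1 hmem
  rw [Real.ball_eq_Ioo, zero_sub, zero_add] at hball
  let f : Curve E M := ⟨fun t => e.symm (c t), ε, hε,
    (contMDiffOn_symm_of_mem_maximalAtlas he).comp hcs.contMDiff.contMDiffOn hball⟩
  have f0 : f.toFun 0 = x := by
    change e.symm (c 0) = x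
    rw [c0, e.left_inv hx]
  refine ⟨T2.mk f, f0, ?_⟩
  have hev : (fun t => e (f.toFun t)) =ᶠ[𝓝 0] c := by
    filter_upwards [hmem] with t ht using e.right_inv ht
  have hd : ∀ t, HasDerivAt c (a.1 + t • a.2) t := by
    intro t
    have h1 := ((hasDerivAt_id t).smul_const a.1)
    have h2 := (((hasDerivAt_id t).pow 2).div_const 2).smul_const a.2
    have h3 : HasDerivAt c ((1 : ℝ) • a.1 + (((2 : ℕ) : ℝ) * t ^ (2 - 1) * 1 / 2) • a.2) t :=
      (h1.add h2).const_add (e x)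
    convert h3 using 1
    simp
  have hd' : deriv c = fun t => a.1 + t • a.2 := funext fun t => (hd t).deriv
  have hdd : deriv (deriv c) 0 = a.2 := by
    rw [hd']
    have h1 := ((hasDerivAt_id (0 : ℝ)).smul_const a.2).const_add a.1
    simpa using h1.deriv
  have hcoord : (T2.mk f).coord e he =
      (e (f.toFun 0), deriv (fun t => e (f.toFun t)) 0, deriv (deriv fun t => e (f.toFun t)) 0) :=
    if_pos (by rw [f0]; exact hx)
  rw [hcoord, hev.deriv.deriv_eq, hev.deriv_eq, hdd, f0, hd']
  simp

theorem T2.coord_fst {e : OpenPartialHomeomorph M E}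
    (he : e ∈ IsManifold.maximalAtlas 𝓘(ℝ, E) ∞ M) {τ : T2 E M} (hτ : τ.base ∈ e.source) :
    (τ.coord e he).1 = e τ.base := by
  induction τ using Quotient.inductionOn with
  | h f => exact congrArg Prod.fst (if_pos hτ)

/-- The map `T²g` in charts: `(y, u, w) ↦ (θ y, Dθ(y) u, Dθ(y) w + D²θ(y)(u, u))`. -/
theorem T2.coord_map {e : OpenPartialHomeomorph M E} {e' : OpenPartialHomeomorph M' E'}
    (he : e ∈ IsManifold.maximalAtlas 𝓘(ℝ, E) ∞ M)
    (he' : e' ∈ IsManifold.maximalAtlas 𝓘(ℝ, E') ∞ M') {g : M → M'}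
    (hg : ContMDiff 𝓘(ℝ, E) 𝓘(ℝ, E') ∞ g) {τ : T2 E M} (hx : τ.base ∈ e.source)
    (hx' : g τ.base ∈ e'.source) {y u w : E} (hτ : τ.coord e he = (y, u, w)) :
    (τ.map g hg).coord e' he' = (localForm e e' g y, fderiv ℝ (localForm e e' g) y u,
      fderiv ℝ (localForm e e' g) y w + fderiv ℝ (fderiv ℝ (localForm e e' g)) y u u) := by
  induction τ using Quotient.inductionOn with
  | h f =>
    obtain ⟨ε, hε, hf⟩ := f.smooth
    have hf0 : ContMDiffAt 𝓘(ℝ, ℝ) 𝓘(ℝ, E) ∞ f.toFun 0 :=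
      hf.contMDiffAt (isOpen_Ioo.mem_nhds ⟨by linarith, hε⟩)
    have hx : f.toFun 0 ∈ e.source := hx
    have hx' : g (f.toFun 0) ∈ e'.source := hx'
    have hc : ContDiffAt ℝ ∞ (fun t => e (f.toFun t)) 0 :=
      ((contMDiffAt_of_mem_maximalAtlas he hx).comp 0 hf0).contDiffAt
    have h1 : T2.coord e he (T2.mk f) =
        (e (f.toFun 0), deriv (fun t => e (f.toFun t)) 0,
          deriv (deriv fun t => e (f.toFun t)) 0) := if_pos hx
    have h2 : T2.coord e' he' (T2.mk (f.map g hg)) =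
        (e' (g (f.toFun 0)), deriv (fun t => e' (g (f.toFun t))) 0,
          deriv (deriv fun t => e' (g (f.toFun t))) 0) := if_pos hx'
    have h3 := h1.symm.trans hτ
    simp only [Prod.mk.injEq] at h3
    have hev : (fun t => e' (g (f.toFun t))) =ᶠ[𝓝 0]
        fun t => localForm e e' g (e (f.toFun t)) := by
      filter_upwards [hf0.continuousAt.preimage_mem_nhds (e.open_source.mem_nhds hx)] with t ht
        using (localForm_chart e' g ht).symm
    have h4 := deriv_deriv_comp (g := localForm e e' g) (c := fun t => e (f.toFun t)) (t := 0)
      (contDiffAt_localForm he he' hg hx hx') hc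
    refine h2.trans ?_
    rw [hev.deriv.deriv_eq, hev.deriv_eq, h4.1, h4.2, h3.2.1, h3.2.2, h3.1,
      ← localForm_chart e' g hx, h3.1]

/-- This and the two lemmas after it let a change of chart or trivialization be treated as the case
g = id of functoriality. -/
theorem T2.map_id (τ : T2 E M) : τ.map id contMDiff_id = τ := by
  induction τ using Quotient.inductionOn with
  | h f => rfl

theorem tmap_id : tmap (E := E) (E' := E) (id : M → M) = id := tangentMap_id

theorem ttmap_id : ttmap (E := E) (E' := E) (id : M → M) = id := by
  unfold ttmap
  rw [tmap_id]
  exact tangentMap_id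

end Coordinates

end SecondTangent

namespace SecondTangent

theorem minSmoothness_two_le_infty : minSmoothness ℝ 2 ≤ ∞ := by
  rw [minSmoothness_of_isRCLikeNormedField]
  exact WithTop.coe_le_coe.2 le_top

/-! ### The connection determined by trivializations of T²M on a single manifold. -/

section Connection

variable {E : Type*} [NormedAddCommGroup E] [NormedSpace ℝ E]
  {M : Type*} [TopologicalSpace M] [ChartedSpace E M] [IsManifold 𝓘(ℝ, E) ∞ M]
  {E' : Type*} [NormedAddCommGroup E'] [NormedSpace ℝ E']
  {M' : Type*} [TopologicalSpace M'] [ChartedSpace E' M'] [IsManifold 𝓘(ℝ, E') ∞ M']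

namespace IsTrivialization

variable {U : Set M} {Φ : T2 E M → E × E} {U' : Set M'} {Φ' : T2 E' M' → E' × E'}

/-- The trivialization `Φ` in the chart of `T²M` induced by a chart `e` of `M`. -/
noncomputable def localRep (h : IsTrivialization U Φ) {e : OpenPartialHomeomorph M E}
    (he : e ∈ IsManifold.maximalAtlas 𝓘(ℝ, E) ∞ M) : E × E × E → E × E :=
  (h.smooth e he).choose

variable (h : IsTrivialization U Φ) (h' : IsTrivialization U' Φ')
  {e : OpenPartialHomeomorph M E} (he : e ∈ IsManifold.maximalAtlas 𝓘(ℝ, E) ∞ M)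
  {e' : OpenPartialHomeomorph M' E'} (he' : e' ∈ IsManifold.maximalAtlas 𝓘(ℝ, E') ∞ M')

theorem contDiffOn_localRep :
    ContDiffOn ℝ ∞ (h.localRep he) ((e '' (e.source ∩ U)) ×ˢ univ) :=
  (h.smooth e he).choose_spec.1

theorem eq_localRep {τ : T2 E M} (hτ : τ.base ∈ e.source ∩ U) :
    Φ τ = h.localRep he (τ.coord e he) :=
  (h.smooth e he).choose_spec.2 τ hτ

theorem isOpen_image (h : IsTrivialization U Φ) (e : OpenPartialHomeomorph M E) : IsOpen (e '' (e.source ∩ U)) :=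
  e.isOpen_image_source_inter h.isOpen

theorem contDiff_localRep {x : M} (hx : x ∈ e.source ∩ U) :
    ContDiff ℝ ∞ fun a => h.localRep he (e x, a) := by
  rw [← contDiffOn_univ]
  exact (h.contDiffOn_localRep he).comp (contDiff_const.prodMk contDiff_id).contDiffOn
    fun a _ => ⟨mem_image_of_mem e hx, mem_univ _⟩

/-- Restricted to the fibre, the function H from `smooth_symm` is a differentiable two-sided inverse
of the local representative, so the chain rule inverts the derivative. -/
theorem isInvertible_localRep {x : M} (hx : x ∈ e.source ∩ U) :
    (fderiv ℝ (fun a => h.localRep he (e x, a)) 0).IsInvertible := by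
  obtain ⟨H, hH, hΦH⟩ := h.smooth_symm e he
  set g : E × E → E × E := fun a => h.localRep he (e x, a) with hg
  have hgs : Differentiable ℝ g := (h.contDiff_localRep he hx).differentiable (by simp)
  have hHs : Differentiable ℝ fun b => H (e x, b) := by
    have : ContDiff ℝ ∞ fun b => H (e x, b) := by
      rw [← contDiffOn_univ]
      exact hH.comp (contDiff_const.prodMk contDiff_id).contDiffOn
        fun a _ => ⟨mem_image_of_mem e hx, mem_univ _⟩
    exact this.differentiable (by simp)
  -- Each a is the coordinate of some class over x; the opposite composition below uses surjectivity
  -- of Φ on the fibre instead.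
  have hHg : ∀ a, H (e x, g a) = a := by
    intro a
    obtain ⟨τ, hτ, hτa⟩ := T2.exists_coord he hx.1 a
    have hmem : τ.base ∈ e.source ∩ U := by rwa [hτ]
    have h1 := hΦH τ hmem
    rw [h.eq_localRep he hmem, hτa, hτ] at h1
    exact h1.symm
  have hgH : ∀ b, g (H (e x, b)) = b := by
    intro b
    obtain ⟨τ, hτ : τ.base = x, hτb⟩ := (h.bijOn x hx.2).surjOn (mem_univ b)
    have hmem : τ.base ∈ e.source ∩ U := by rwa [hτ]
    have h1 := hΦH τ hmem
    have h2 := T2.coord_fst he hmem.1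
    rw [hτ, hτb] at h1
    rw [hτ] at h2
    change h.localRep he (e x, H (e x, b)) = b
    rw [← h1, ← h2, ← hτb, h.eq_localRep he hmem]
  have e1 : HasFDerivAt (fun a => H (e x, g a)) _ 0 :=
    (hHs (g 0)).hasFDerivAt.comp (0 : E × E) (hgs 0).hasFDerivAt
  rw [funext hHg] at e1
  have e2 : HasFDerivAt (fun b => g (H (e x, b))) _ (g 0) :=
    HasFDerivAt.comp (g := g) (f := fun b => H (e x, b)) (g 0) (hgs _).hasFDerivAt
      (hHs (g 0)).hasFDerivAt
  -- By `hHg 0` the derivative of g in `e2` is taken at 0, the same point as in `e1`.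
  rw [funext hgH, hHg 0] at e2
  exact .of_inverse (e2.unique (hasFDerivAt_id _)) (e1.unique (hasFDerivAt_id _))

/-- The Christoffel symbol, in a chart of `M`, of the connection determined by a trivialization of
`T²M`: the fibre of `T²M` over `x` gets the flat connection of `E × E`, whose Christoffel symbol
at the class of the constant curve is evaluated at horizontal vectors and projected to the vertical
ones. -/
noncomputable def christoffel (y : E) : E →L[ℝ] E →L[ℝ] E :=
  verticalSymbol fun a => h.localRep he (y, a)

theorem contDiffOn_christoffel [CompleteSpace E] :
    ContDiffOn ℝ ∞ (h.christoffel he) (e '' (e.source ∩ U)) := by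
  refine contDiffOn_verticalSymbol (h.isOpen_image e) (h.contDiffOn_localRep he) ?_
  rintro _ ⟨x, hx, rfl⟩
  exact h.isInvertible_localRep he hx

/-- The Christoffel symbols transform like those of related connections under a map whose
second tangent map is linear with respect to the trivializations. -/
theorem christoffel_transform {g : M → M'} (hg : ContMDiff 𝓘(ℝ, E) 𝓘(ℝ, E') ∞ g)
    {x : M} (hx : x ∈ e.source ∩ U) (hx' : g x ∈ e'.source ∩ U') (L : E × E →L[ℝ] E' × E')
    (hL : ∀ τ : T2 E M, τ.base = x → Φ' (τ.map g hg) = L (Φ τ)) (u v : E) :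
    fderiv ℝ (localForm e e' g) (e x) (h.christoffel he (e x) u v) =
      h'.christoffel he' (e' (g x)) (fderiv ℝ (localForm e e' g) (e x) u)
        (fderiv ℝ (localForm e e' g) (e x) v) +
      fderiv ℝ (fderiv ℝ (localForm e e' g)) (e x) u v := by
  -- Here A and B are the first two derivatives of the local form, and the symmetry of second
  -- derivatives supplies the hypothesis on B.
  have hsymm := (contDiffAt_localForm he he' hg hx.1 hx'.1).isSymmSndFDerivAt
    minSmoothness_two_le_infty
  refine verticalSymbol_transform (h.contDiff_localRep he hx) (h'.contDiff_localRep he' hx')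
    (h.isInvertible_localRep he hx) (h'.isInvertible_localRep he' hx') L _ _
    (fun u v => hsymm u v) (fun u w => ?_) u v
  obtain ⟨τ, hτ, hτa⟩ := T2.exists_coord he hx.1 (u, w)
  have hmem : τ.base ∈ e.source ∩ U := by rwa [hτ]
  have hbase : (τ.map g hg).base = g τ.base := by
    induction τ using Quotient.inductionOn with
    | h f => rfl
  have hmem' : (τ.map g hg).base ∈ e'.source ∩ U' := by rwa [hbase, hτ]
  have h1 := hL τ hτ
  rw [h.eq_localRep he hmem, h'.eq_localRep he' hmem', hτa,
    T2.coord_map he he' hg hmem.1 (hbase ▸ hmem'.1) hτa, localForm_chart e' g hx.1] at h1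
  exact h1

/-- If the local form is linear near the point, its second derivative vanishes and the inhomogeneous
term of the transformation law disappears. This covers the identity in a single chart and φʲⁱ in
limit charts. -/
theorem christoffel_of_linear {g : M → M'} (hg : ContMDiff 𝓘(ℝ, E) 𝓘(ℝ, E') ∞ g)
    {x : M} (hx : x ∈ e.source ∩ U) (hx' : g x ∈ e'.source ∩ U') (L : E × E →L[ℝ] E' × E')
    (hL : ∀ τ : T2 E M, τ.base = x → Φ' (τ.map g hg) = L (Φ τ)) (A : E →L[ℝ] E')
    (hA : localForm e e' g =ᶠ[𝓝 (e x)] A) (u v : E) :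
    A (h.christoffel he (e x) u v) = h'.christoffel he' (e' (g x)) (A u) (A v) := by
  have hev : fderiv ℝ (localForm e e' g) =ᶠ[𝓝 (e x)] fun _ => A :=
    hA.fderiv.trans (.of_forall fun y => A.fderiv)
  have := h.christoffel_transform h' he he' hg hx hx' L hL u v
  rw [hev.fderiv_eq, hev.self_of_nhds] at this
  simpa using this

/-- The connection over `e.source ∩ U` determined by a trivialization of `T²M` over `U`. -/
noncomputable def connection (Z : TTM E M) : TM E M :=
  ofTanCoord e Z.proj.proj ((ttanCoord e Z).2.2 +
    h.christoffel he (ttanCoord e Z).1.1 (ttanCoord e Z).1.2 (ttanCoord e Z).2.1)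

/-- The second tangent map adds D²θ(v, u) to Dθ(w), while the law for the symbols adds D²θ(u, v) to
Γ'(Dθ(u), Dθ(v)). By symmetry both sides become Dθ(w) + Γ'(Dθ(u), Dθ(v)) + D²θ(v, u). -/
theorem tmap_connection {g : M → M'} (hg : ContMDiff 𝓘(ℝ, E) 𝓘(ℝ, E') ∞ g)
    {Z : TTM E M} (hx : Z.proj.proj ∈ e.source ∩ U) (hx' : g Z.proj.proj ∈ e'.source ∩ U')
    (L : E × E →L[ℝ] E' × E')
    (hL : ∀ τ : T2 E M, τ.base = Z.proj.proj → Φ' (τ.map g hg) = L (Φ τ)) :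
    tmap g (h.connection he Z) = h'.connection he' (ttmap g Z) := by
  obtain ⟨⟨⟨y, u⟩, v, w⟩, hZ⟩ : ∃ q, ttanCoord e Z = q := ⟨_, rfl⟩
  have hy : y = e Z.proj.proj := (congrArg (fun q => q.1.1) hZ).symm
  refine tanCoord_injOn he' hx'.1 rfl ?_
  rw [tanCoord_tmap (v := h.connection he Z) he he' hg hx.1 hx'.1]
  unfold connection
  have e1 : (ttmap g Z : TTM E' M').proj.proj = g Z.proj.proj := rfl
  have hx'' : (ttmap g Z : TTM E' M').proj.proj ∈ e'.source := hx'.1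
  rw [tanCoord_ofTanCoord he hx.1, tanCoord_ofTanCoord he' hx'',
    ttanCoord_ttmap he he' hg hx.1 hx'.1 hZ, hZ]
  dsimp only
  rw [hy, map_add, h.christoffel_transform h' he he' hg hx hx' L hL,
    (contDiffAt_localForm he he' hg hx.1 hx'.1).isSymmSndFDerivAt
      minSmoothness_two_le_infty u v,
    localForm_chart e' g hx.1]
  abel

/-- The connection does not depend on the chart, nor on the trivialization within its class of
linearly related ones. -/
theorem connection_eq {U₁ : Set M} {Φ₁ : T2 E M → E × E} (h₁ : IsTrivialization U₁ Φ₁)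
    {e₁ : OpenPartialHomeomorph M E} (he₁ : e₁ ∈ IsManifold.maximalAtlas 𝓘(ℝ, E) ∞ M)
    {Z : TTM E M} (hx : Z.proj.proj ∈ e.source ∩ U) (hx₁ : Z.proj.proj ∈ e₁.source ∩ U₁)
    (L : E × E →L[ℝ] E × E)
    (hL : ∀ τ : T2 E M, τ.base = Z.proj.proj → Φ₁ τ = L (Φ τ)) :
    h.connection he Z = h₁.connection he₁ Z := by
  have := h.tmap_connection h₁ he he₁ (contMDiff_id (M := M)) hx hx₁ L
    fun τ hτ => by rw [T2.map_id, hL τ hτ]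
  rwa [tmap_id, ttmap_id] at this

end IsTrivialization

/-! ### Gluing the local connections over an atlas of linearly related trivializations. -/

/-- A family of trivializations of `T²M` over sets covering `M`, with linear transition maps. -/
structure LinearAtlas (E : Type*) [NormedAddCommGroup E] [NormedSpace ℝ E]
    (M : Type*) [TopologicalSpace M] [ChartedSpace E M] [IsManifold 𝓘(ℝ, E) ∞ M] where
  ι : Type*
  U : ι → Set M
  Φ : ι → T2 E M → E × E
  isTrivialization : ∀ α, IsTrivialization (U α) (Φ α)
  cover : ∀ x, ∃ α, x ∈ U α
  transition : ∀ α β, ∀ x ∈ U α ∩ U β, ∃ L : E × E →L[ℝ] E × E,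
    ∀ τ : T2 E M, τ.base = x → Φ α τ = L (Φ β τ)

namespace LinearAtlas

/-- The linear connection on `M` determined by a linear atlas of `T²M`. -/
noncomputable def connection (A : LinearAtlas E M) (Z : TTM E M) : TM E M :=
  (A.isTrivialization (A.cover Z.proj.proj).choose).connection
    (IsManifold.chart_mem_maximalAtlas (I := 𝓘(ℝ, E)) (n := ∞) Z.proj.proj) Z

variable (A : LinearAtlas E M) (A' : LinearAtlas E' M')

/-- The second tangent map of `g` is linear on the fibre over `x`. -/
def LinearAt (g : M → M') (hg : ContMDiff 𝓘(ℝ, E) 𝓘(ℝ, E') ∞ g) (x : M) : Prop :=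
  ∃ α α', x ∈ A.U α ∧ g x ∈ A'.U α' ∧
    ∃ L : E × E →L[ℝ] E' × E', ∀ τ : T2 E M, τ.base = x → A'.Φ α' (τ.map g hg) = L (A.Φ α τ)

/-- The definition picks a trivialization and a chart separately at every point. Linearity of the
transition maps makes these choices immaterial. -/
theorem connection_eq (α : A.ι) {e : OpenPartialHomeomorph M E}
    (he : e ∈ IsManifold.maximalAtlas 𝓘(ℝ, E) ∞ M) {Z : TTM E M}
    (hx : Z.proj.proj ∈ e.source ∩ A.U α) :
    A.connection Z = (A.isTrivialization α).connection he Z := by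
  have hβ := (A.cover Z.proj.proj).choose_spec
  obtain ⟨L, hL⟩ := A.transition α _ Z.proj.proj ⟨hx.2, hβ⟩
  exact IsTrivialization.connection_eq _ _ _ _ ⟨mem_chart_source E _, hβ⟩ hx L hL

/-- The Christoffel symbol of the connection in a chart. -/
noncomputable def christoffel {e : OpenPartialHomeomorph M E}
    (he : e ∈ IsManifold.maximalAtlas 𝓘(ℝ, E) ∞ M) (y : E) : E →L[ℝ] E →L[ℝ] E :=
  (A.isTrivialization (A.cover (e.symm y)).choose).christoffel he y

theorem christoffel_eq (α : A.ι) {e : OpenPartialHomeomorph M E}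
    (he : e ∈ IsManifold.maximalAtlas 𝓘(ℝ, E) ∞ M) {x : M} (hx : x ∈ e.source ∩ A.U α) :
    A.christoffel he (e x) = (A.isTrivialization α).christoffel he (e x) := by
  have hβ : x ∈ A.U (A.cover (e.symm (e x))).choose := by
    have hβ := (A.cover (e.symm (e x))).choose_spec
    -- The chosen index itself contains `e.symm (e x)`; it is generalized so that only the point is
    -- rewritten.
    generalize (A.cover (e.symm (e x))).choose = β at hβ ⊢
    rwa [e.left_inv hx.1] at hβ
  obtain ⟨L, hL⟩ := A.transition α _ x ⟨hx.2, hβ⟩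
  have hid : localForm e e id =ᶠ[𝓝 (e x)] ContinuousLinearMap.id ℝ E := by
    filter_upwards [e.open_target.mem_nhds (e.map_source hx.1)] with y hy using e.right_inv hy
  ext u v
  have := IsTrivialization.christoffel_of_linear (A.isTrivialization _) (A.isTrivialization α) he he
    (contMDiff_id (M := M)) ⟨hx.1, hβ⟩ hx L (fun τ hτ => by rw [T2.map_id, hL τ hτ]) _ hid u v
  rw [LinearAtlas.christoffel]
  simpa only [ContinuousLinearMap.id_apply, id_eq] using this

/-- Functoriality of the Christoffel symbols for maps that are linear in charts. -/
theorem christoffel_of_linear {e : OpenPartialHomeomorph M E}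
    (he : e ∈ IsManifold.maximalAtlas 𝓘(ℝ, E) ∞ M) {e' : OpenPartialHomeomorph M' E'}
    (he' : e' ∈ IsManifold.maximalAtlas 𝓘(ℝ, E') ∞ M') {g : M → M'}
    (hg : ContMDiff 𝓘(ℝ, E) 𝓘(ℝ, E') ∞ g) {x : M} (hx : x ∈ e.source) (hx' : g x ∈ e'.source)
    (hL : A.LinearAt A' g hg x) (T : E →L[ℝ] E') (hT : localForm e e' g =ᶠ[𝓝 (e x)] T) (u v : E) :
    T (A.christoffel he (e x) u v) = A'.christoffel he' (e' (g x)) (T u) (T v) := by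
  obtain ⟨α, α', hα, hα', L, hL⟩ := hL
  rw [A.christoffel_eq α he ⟨hx, hα⟩, A'.christoffel_eq α' he' ⟨hx', hα'⟩]
  exact IsTrivialization.christoffel_of_linear _ _ he he' hg ⟨hx, hα⟩ ⟨hx', hα'⟩ L hL T hT u v

/-- The pointwise choice of a trivialization need not vary regularly, but near each point the symbol
agrees with that of one fixed trivialization, which is smooth. -/
theorem contDiffOn_christoffel [CompleteSpace E] {e : OpenPartialHomeomorph M E}
    (he : e ∈ IsManifold.maximalAtlas 𝓘(ℝ, E) ∞ M) :
    ContDiffOn ℝ ∞ (A.christoffel he) e.target := by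
  intro y hy
  obtain ⟨α, hα⟩ := A.cover (e.symm y)
  have hx : e.symm y ∈ e.source ∩ A.U α := ⟨e.map_target hy, hα⟩
  have hmem : e '' (e.source ∩ A.U α) ∈ 𝓝 y :=
    ((A.isTrivialization α).isOpen_image e).mem_nhds ⟨_, hx, e.right_inv hy⟩
  refine ContDiffAt.contDiffWithinAt ?_
  refine (((A.isTrivialization α).contDiffOn_christoffel he).contDiffAt hmem).congr_of_eventuallyEq
    ?_
  filter_upwards [hmem] with z hz
  obtain ⟨x, hx, rfl⟩ := hz
  exact A.christoffel_eq α he hx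

theorem tanCoord_connection {e : OpenPartialHomeomorph M E}
    (he : e ∈ IsManifold.maximalAtlas 𝓘(ℝ, E) ∞ M) {Z : TTM E M}
    (hx : Z.proj.proj ∈ e.source) {y u v w : E} (hZ : ttanCoord e Z = ((y, u), (v, w))) :
    tanCoord e (A.connection Z) = (y, w + A.christoffel he y u v) := by
  obtain ⟨α, hα⟩ := A.cover Z.proj.proj
  have hy : y = e Z.proj.proj := (congrArg (fun q => q.1.1) hZ).symm
  rw [A.connection_eq α he ⟨hx, hα⟩, IsTrivialization.connection, tanCoord_ofTanCoord he hx, hZ,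
    hy, A.christoffel_eq α he ⟨hx, hα⟩]

theorem isLinearConnection [CompleteSpace E] : IsLinearConnection A.connection := fun _ he =>
  ⟨A.christoffel he, A.contDiffOn_christoffel he, fun _ hZ =>
    ⟨rfl, fun _ _ _ _ h => A.tanCoord_connection he hZ h⟩⟩

theorem tmap_connection {g : M → M'} (hg : ContMDiff 𝓘(ℝ, E) 𝓘(ℝ, E') ∞ g) (Z : TTM E M)
    (hL : A.LinearAt A' g hg Z.proj.proj) :
    tmap g (A.connection Z) = A'.connection (ttmap g Z) := by
  obtain ⟨α, α', hα, hα', L, hL⟩ := hL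
  have hx : Z.proj.proj ∈ (chartAt E Z.proj.proj).source ∩ A.U α := ⟨mem_chart_source E _, hα⟩
  have hx' : g Z.proj.proj ∈ (chartAt E' (g Z.proj.proj)).source ∩ A'.U α' :=
    ⟨mem_chart_source E' _, hα'⟩
  rw [A.connection_eq α (IsManifold.chart_mem_maximalAtlas _) hx,
    A'.connection_eq α' (Z := ttmap g Z) (IsManifold.chart_mem_maximalAtlas _) hx']
  exact IsTrivialization.tmap_connection _ _ _ _ hg hx hx' L hL

end LinearAtlas

end Connection

end SecondTangent

namespace SecondTangent

/-! ### Smooth curves in the limit space, and the projective limit of the connections. -/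

section Limit

variable {E : ℕ → Type*} [∀ i, NormedAddCommGroup (E i)] [∀ i, NormedSpace ℝ (E i)]
  {M : ℕ → Type*} [∀ i, TopologicalSpace (M i)] [∀ i, ChartedSpace (E i) (M i)]
  [∀ i, IsManifold 𝓘(ℝ, E i) ∞ (M i)]

theorem IsSmoothCurve.map_clm {F G : Type*} [AddCommGroup F] [Module ℝ F] [TopologicalSpace F]
    [AddCommGroup G] [Module ℝ G] [TopologicalSpace G] {c : ℝ → F} (hc : IsSmoothCurve c)
    (L : F →L[ℝ] G) : IsSmoothCurve fun t => L (c t) := by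
  obtain ⟨d, rfl, hd⟩ := hc
  refine ⟨fun n t => L (d n t), rfl, fun n t => ?_⟩
  refine ((L.continuous.tendsto _).comp (hd n t)).congr fun s => ?_
  simp [slope]

/-- The functions witnessing smoothness are forced to be the iterated derivatives. With
`IsSmoothCurve.map_clm` this makes the components of a smooth curve in F smooth in the usual sense.
-/
theorem IsSmoothCurve.contDiff {V : Type*} [NormedAddCommGroup V] [NormedSpace ℝ V] {c : ℝ → V}
    (hc : IsSmoothCurve c) : ContDiff ℝ ∞ c := by
  obtain ⟨d, rfl, hd⟩ := hc
  have hd' : ∀ n t, HasDerivAt (d n) (d (n + 1) t) t := fun n t =>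
    hasDerivAt_iff_tendsto_slope.2 (hd n t)
  have hit : ∀ n, iteratedDeriv n (d 0) = d n := by
    intro n
    induction n with
    | zero => simp
    | succ n ih => rw [iteratedDeriv_succ, ih]; exact funext fun t => (hd' n t).deriv
  refine contDiff_of_differentiable_iteratedDeriv fun m _ => ?_
  rw [hit]
  exact fun t => (hd' m t).differentiableAt

theorem iteratedDeriv_clm_comp {V W : Type*} [NormedAddCommGroup V] [NormedSpace ℝ V]
    [NormedAddCommGroup W] [NormedSpace ℝ W] (L : V →L[ℝ] W) {c : ℝ → V} (hc : ContDiff ℝ ∞ c)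
    (n : ℕ) : iteratedDeriv n (fun t => L (c t)) = fun t => L (iteratedDeriv n c t) := by
  induction n with
  | zero => simp
  | succ n ih =>
    rw [iteratedDeriv_succ, iteratedDeriv_succ, ih]
    refine funext fun t => ?_
    have h := (hc.differentiable_iteratedDeriv n (by exact_mod_cast ENat.natCast_lt_top n)) t
    exact (L.hasFDerivAt.comp_hasDerivAt t h.hasDerivAt).deriv

namespace ProjSystem

variable (P : ProjSystem E M)

/-- The canonical projection `F → Eⁱ`. -/
def modelProj (i : ℕ) : P.F →L[ℝ] E i :=
  (ContinuousLinearMap.proj i).comp P.modelSpace.subtypeL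

/-- A curve in `F = lim Eⁱ` is smooth if its components are. -/
theorem isSmoothCurve_of_components {c : ℝ → P.F} (hc : ∀ i, ContDiff ℝ ∞ fun t => (c t).1 i) :
    IsSmoothCurve c := by
  -- The derivatives are taken componentwise. They stay in the limit because ρʲⁱ commutes with
  -- differentiation, and difference quotients converge because the topology is induced from the
  -- product.
  refine ⟨fun n t => ⟨fun i => iteratedDeriv n (fun t => (c t).1 i) t, fun i j h => ?_⟩, ?_,
    fun n t => ?_⟩
  · have h1 : (fun t => (c t).1 i) = fun t => P.ρ h ((c t).1 j) :=
      funext fun t => ((c t).2 i j h).symm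
    simp only [h1]
    rw [iteratedDeriv_clm_comp (P.ρ h) (hc j) n]
  · funext t
    ext i
    simp
  · rw [tendsto_subtype_rng, tendsto_pi_nhds]
    intro i
    have h := ((hc i).differentiable_iteratedDeriv n (by exact_mod_cast ENat.natCast_lt_top n)) t
    have h' := hasDerivAt_iff_tendsto_slope.1 h.hasDerivAt
    rw [← iteratedDeriv_succ] at h'
    refine h'.congr fun s => ?_
    simp [slope]

variable {P}

/-- The linear atlas of `T²Mⁱ` underlying an `H⁰(F × F)`-vector bundle structure of `T²M`. -/
def H0VectorBundle.factor (B : P.H0VectorBundle) (i : ℕ) : LinearAtlas (E i) (M i) where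
  ι := B.ι
  U α := (B.triv α).U i
  Φ α := (B.triv α).Φ i
  isTrivialization α := (B.triv α).isTrivialization i
  cover := B.cover_factor i
  transition α β x hx := by
    obtain ⟨T, -, hT, -⟩ := B.transition α β
    exact ⟨T i x, fun τ hτ => by rw [hT i τ (by rwa [hτ]), hτ]; rfl⟩

theorem H0VectorBundle.linearAt (B : P.H0VectorBundle) {i j : ℕ} (h : i ≤ j) (x : M j) :
    (B.factor j).LinearAt (B.factor i) (P.φ h) (P.smooth h) x := by
  -- A point of Mʲ need not come from the limit, so the covering of the factor is used. One index α
  -- serves both levels, with L = ρʲⁱ × ρʲⁱ.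
  obtain ⟨α, hα⟩ := B.cover_factor j x
  exact ⟨α, α, hα, (B.triv α).mapsTo h hα, (P.ρ h).prodMap (P.ρ h), fun τ hτ =>
    (B.triv α).compat h τ (by rwa [hτ])⟩

theorem LimChart.localForm_eventuallyEq (c : P.LimChart) {i j : ℕ} (h : i ≤ j) {y : E j}
    (hy : y ∈ (c.chart j).target) :
    localForm (c.chart j) (c.chart i) (P.φ h) =ᶠ[𝓝 y] P.ρ h := by
  filter_upwards [(c.chart j).open_target.mem_nhds hy] with z hz
  rw [localForm, c.compat h _ ((c.chart j).map_target hz), (c.chart j).right_inv hz]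

/-- In a limit chart φʲⁱ has local form ρʲⁱ, so no second-order term appears. This compatibility is
what makes the componentwise symbol take values in F. -/
theorem H0VectorBundle.ρ_christoffel (B : P.H0VectorBundle) (c : P.LimChart) {y : P.F}
    (hy : y ∈ c.target) {i j : ℕ} (h : i ≤ j) (u v : E j) :
    P.ρ h ((B.factor j).christoffel (c.mem_atlas j) (y.1 j) u v) =
      (B.factor i).christoffel (c.mem_atlas i) (y.1 i) (P.ρ h u) (P.ρ h v) := by
  have hx := (c.chart j).map_target (hy j)
  have h1 := (c.chart j).right_inv (hy j)
  have h2 := (B.factor j).christoffel_of_linear (B.factor i) (c.mem_atlas j) (c.mem_atlas i)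
    (P.smooth h) hx (c.mapsTo h hx) (B.linearAt h _) (P.ρ h)
    (c.localForm_eventuallyEq h (by rw [h1]; exact hy j)) u v
  rwa [c.compat h _ hx, h1, y.2 i j h] at h2

open Classical in
/-- The Christoffel symbol `lim Γⁱ` in a limit chart (zero outside the image of the chart). -/
noncomputable def H0VectorBundle.christoffel (B : P.H0VectorBundle) (c : P.LimChart) (y : P.F) :
    P.F →ₗ[ℝ] P.F →ₗ[ℝ] P.F :=
  if hy : y ∈ c.target then
    LinearMap.mk₂ ℝ (fun u v => ⟨fun i =>
        (B.factor i).christoffel (c.mem_atlas i) (y.1 i) (u.1 i) (v.1 i), fun i j h => by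
        rw [B.ρ_christoffel c hy h, u.2 i j h, v.2 i j h]⟩)
      (fun u u' v => by ext i; simp) (fun r u v => by ext i; simp)
      (fun u v v' => by ext i; simp) (fun r u v => by ext i; simp)
  else 0

theorem H0VectorBundle.christoffel_apply (B : P.H0VectorBundle) (c : P.LimChart) {y : P.F}
    (hy : y ∈ c.target) (u v : P.F) (i : ℕ) : (B.christoffel c y u v).1 i =
      (B.factor i).christoffel (c.mem_atlas i) (y.1 i) (u.1 i) (v.1 i) := by
  rw [H0VectorBundle.christoffel, dif_pos hy]
  rfl

/-- Each component factors through the projection to Eⁱ × Eⁱ × Eⁱ and a smooth map of Banach spaces.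
Continuity and smoothness along curves are both detected on components. -/
theorem H0VectorBundle.isSmoothOn_christoffel [∀ i, CompleteSpace (E i)] (B : P.H0VectorBundle)
    (c : P.LimChart) : IsSmoothOn (fun p : P.F × P.F × P.F => B.christoffel c p.1 p.2.1 p.2.2)
      (c.target ×ˢ univ) := by
  have hs : ∀ i, ContDiffOn ℝ ∞ (fun q : E i × E i × E i =>
      (B.factor i).christoffel (c.mem_atlas i) q.1 q.2.1 q.2.2)
      ((c.chart i).target ×ˢ univ) := fun i =>
    ((((B.factor i).contDiffOn_christoffel (c.mem_atlas i)).comp contDiff_fst.contDiffOn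
      fun q hq => hq.1).clm_apply (contDiff_fst.comp contDiff_snd).contDiffOn).clm_apply
      (contDiff_snd.comp contDiff_snd).contDiffOn
  let π : ∀ i, P.F × P.F × P.F →L[ℝ] E i × E i × E i := fun i =>
    (P.modelProj i).prodMap ((P.modelProj i).prodMap (P.modelProj i))
  refine ⟨?_, fun γ hγ hsm => P.isSmoothCurve_of_components fun i => ?_⟩
  · refine Topology.IsInducing.subtypeVal.continuousOn_iff.2 (continuousOn_pi.2 fun i => ?_)
    refine ((hs i).continuousOn.comp (π i).continuous.continuousOn
      fun p hp => ⟨hp.1 i, mem_univ _⟩).congr fun p hp => ?_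
    exact B.christoffel_apply c hp.1 _ _ i
  · have h1 : ContDiff ℝ ∞ fun t => π i (γ t) := (hsm.map_clm (π i)).contDiff
    have h2 := (hs i).comp_contDiff h1 fun t => ⟨(hγ t).1 i, mem_univ _⟩
    convert h2 using 2 with t
    exact B.christoffel_apply c (hγ t).1 _ _ i

/-- The projective limit of the connections determined by the linear atlases of the `T²Mⁱ`. -/
noncomputable def H0VectorBundle.connection (B : P.H0VectorBundle) (Z : P.TTLim) : P.TLim :=
  ⟨fun i => (B.factor i).connection (Z.1 i), fun i j h => by
    rw [(B.factor j).tmap_connection (B.factor i) (P.smooth h) _ (B.linearAt h _), Z.2 i j h]⟩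

theorem H0VectorBundle.isLinearConnection [∀ i, CompleteSpace (E i)] (B : P.H0VectorBundle) :
    P.IsLinearConnection B.connection := by
  refine fun c => ⟨B.christoffel c, B.isSmoothOn_christoffel c, fun Z hZ => ⟨rfl, ?_⟩⟩
  intro y u v w h
  have hi : ∀ i, SecondTangent.tanCoord (c.chart i) ((B.factor i).connection (Z.1 i)) =
      (y.1 i, w.1 i + (B.factor i).christoffel (c.mem_atlas i) (y.1 i) (u.1 i) (v.1 i)) :=
    fun i => (B.factor i).tanCoord_connection (c.mem_atlas i) (hZ i) (by
      rw [← congrArg (fun q => q.1.1.1 i) h, ← congrArg (fun q => q.1.2.1 i) h,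
        ← congrArg (fun q => q.2.1.1 i) h, ← congrArg (fun q => q.2.2.1 i) h]
      rfl)
  have hy : y ∈ c.target := fun i => by
    rw [← congrArg (fun q => q.1.1.1 i) h]
    exact (c.chart i).map_source (hZ i)
  refine Prod.ext (Subtype.ext (funext fun i => ?_)) (Subtype.ext (funext fun i => ?_))
  · exact congrArg Prod.fst (hi i)
  · refine (congrArg Prod.snd (hi i)).trans ?_
    rw [← B.christoffel_apply c hy u v i]
    rfl

end ProjSystem

end Limit

end SecondTangent

open SecondTangent in
/-- The connections come from the `H⁰`-vector bundle structure alone: the trivializations of `T²Mⁱ`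
endow its fibres with flat structures, whose Christoffel symbols at the classes of the constant
curves give a linear connection on `Mⁱ`; neither `hM` nor the isomorphism `hB` is needed. -/
theorem theorem3p3
    (E : ℕ → Type*) [∀ i, NormedAddCommGroup (E i)] [∀ i, NormedSpace ℝ (E i)]
    [∀ i, CompleteSpace (E i)]
    (M : ℕ → Type*) [∀ i, TopologicalSpace (M i)] [∀ i, ChartedSpace (E i) (M i)]
    [∀ i, IsManifold 𝓘(ℝ, E i) ∞ (M i)]
    (P : ProjSystem E M) (hM : P.IsFrechetManifold)
    (B : P.H0VectorBundle) (hB : B.IsIsoTMTM) :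
    ∃ (D : P.TTLim → P.TLim) (Di : ∀ i, TTM (E i) (M i) → TM (E i) (M i)),
      (∀ i, SecondTangent.IsLinearConnection (Di i)) ∧
      P.IsLinearConnection D ∧
      P.IsProjLimit D Di := by
  refine ⟨B.connection, fun i => (B.factor i).connection, fun i => (B.factor i).isLinearConnection,
    B.isLinearConnection, fun {i j} h Z => ?_, fun _ _ => rfl⟩
  exact (B.factor j).tmap_connection (B.factor i) (P.smooth h) Z (B.linearAt h _)
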